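/- **Setting.** Consider a downlink with $N\ge 1$ cells, $K\ge 1$ single-antenna users per cell and $N_t\ge 1$ antennas per base station. Let $h_{m,i,j}\in\mathbb C^{N_t}$ be the channel from base station $m$ to user $j$ of cell $i$, and assume that all entries of all channel vectors are nonzero. Let $w_{i,j}\in\mathbb C^{N_t}$ be the beamforming vectors, $W_i=[w_{i,1}\cdots w_{i,K}]$, and let $T_n$ be the diagonal matrix whose $n$th diagonal entry is $1$ and whose other entries are $0$. Let $\eta,\nu:[0,\infty)\to[0,\infty)$ be continuous, $\eta$ strictly increasing with $\eta(0)=0$, $\nu$ nondecreasing, and let $\sigma^2>0$. Put $C_m=\mathrm{diag}\big(\eta(\|T_1W_m\|_F)^2,\dots,\eta(\|T_{N_t}W_m\|_F)^2\big)$ and $$\mathrm{SINR}_{i,j}=\frac{|h_{i,i,j}^Hw_{i,j}|^2}{\sum_{l\ne j}|h_{i,i,j}^Hw_{i,l}|^2+\sum_{m\ne i}\|h_{m,i,j}^HW_m\|^2+\sum_m h_{m,i,j}^HC_mh_{m,i,j}+\sigma^2+\nu\Big(\sqrt{\sum_m\|h_{m,i,j}^HW_m\|^2}\Big)^2}.$$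 Performance is measured by continuous strictly increasing functions $g_{i,j}$ on $[0,\infty)$ with $g_{i,j}(0)=0$. The power constraints are given by $L_i$ positive semidefinite matrices $Q_{i,k}$ with $\sum_kQ_{i,k}\succ0$ for every $i$, limits $q_{i,k}>0$ and $\delta\in[0,1]$; write $P_{i,k}(W)=\mathrm{tr}(W_i^HQ_{i,k}W_i)+\delta\,\mathrm{tr}(Q_{i,k}C_i)$. (P1) For given $\gamma_{i,j}\ge0$: minimize $\beta$ over $(\beta,W)$ subject to $g_{i,j}(\mathrm{SINR}_{i,j})\ge\gamma_{i,j}$ for all $i,j$ and $P_{i,k}(W)\le\beta q_{i,k}$ for all $i,k$. (P2) For given $a_{i,j}\ge0$ and $\alpha_{i,j}\ge0$ with $\sum_{i,j}\alpha_{i,j}=1$: maximize $\min_{(i,j):\alpha_{i,j}>0}\,(g_{i,j}(\mathrm{SINR}_{i,j})-a_{i,j})/\alpha_{i,j}$ over $W$ subject to $P_{i,k}(W)\le q_{i,k}$ for all $i,k$ and $g_{i,j}(\mathrm{SINR}_{i,j})\ge a_{i,j}$ for all $i,j$. **Theorem.** Write $p_{i,j}=\|w_{i,j}\|^2$ for the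 power of a user. The following holds for each of the problems (P1) and (P2). 1. *Structure.* Suppose that $\eta$ is convex and that the problem is feasible. Then it has an optimal solution, and for every optimal solution there are parameters $\lambda_{i,k},\mu_{m,l},\tau_{i,n}\in[0,1]$ such that, for all $i$, the matrix $M_i=\sum_k\lambda_{i,k}Q_{i,k}+\sum_{m,l}\mu_{m,l}h_{i,m,l}h_{i,m,l}^H+\sum_n\tau_{i,n}T_n$ is positive definite and, for all $j$, up to multiplication by a complex number of modulus one, $$w_{i,j}=\sqrt{p_{i,j}}\,v_{i,j},\qquad v_{i,j}=\frac{M_i^{-1}h_{i,i,j}}{\|M_i^{-1}h_{i,i,j}\|}.$$ Moreover, there is an optimal solution for which these identities hold exactly, with all phase factors equal to one. 2. *Bounded power.* Suppose that $x/\eta(x)\to0$ as $x\to\infty$, or that $\eta$ is convex and $x/\nu(x)\to0$ as $x\to\infty$ (with $\nu(x)>0$ for large $x$). Then there is $\tilde q<\infty$ such that $p_{i,j}<\tilde q$ for all $i,j$ in every optimal solution, irrespectively of the power constraints. For (P1), and for (P2) if $x/\eta(x)\to0$, the number $\tilde q$ depends neither on the limits $q_{i,k}$ nor on $\delta$, $L_i$,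 $Q_{i,k}$. For (P2) under the second condition, it does not depend on the limits $q_{i,k}$, but it may depend on $\delta$, $L_i$, $Q_{i,k}$. -/

import Mathlib

open Filter Topology Set
open scoped ComplexOrder Matrix

/-- A multicell downlink with `N` cells, `K` users per cell and `Nt` antennas per base station,
together with the transceiver impairment characteristics and the user performance functions. -/
structure DownlinkSystem (N K Nt : ℕ) where
  /-- `h m i j` is the channel vector from base station `m` to user `j` of cell `i`. -/
  h : Fin N → Fin N → Fin K → EuclideanSpace ℂ (Fin Nt)
  /-- thermal noise power (the quantity `σ²`) -/
  noise : ℝ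
  /-- transmitter impairment characteristic, a function of the transmit magnitude `x ≥ 0` -/
  eta : ℝ → ℝ
  /-- receiver impairment characteristic, a function of the received magnitude `x ≥ 0` -/
  nu : ℝ → ℝ
  /-- performance functions of the users, functions of the SINR `x ≥ 0` -/
  g : Fin N → Fin K → ℝ → ℝ
  noise_pos : 0 < noise
  eta_nonneg : ∀ x, 0 ≤ x → 0 ≤ eta x
  eta_strictMono : StrictMonoOn eta (Ici 0)
  eta_cont : ContinuousOn eta (Ici 0)
  nu_nonneg : ∀ x, 0 ≤ x → 0 ≤ nu x
  nu_mono : MonotoneOn nu (Ici 0)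
  nu_cont : ContinuousOn nu (Ici 0)
  g_zero : ∀ i j, g i j 0 = 0
  g_strictMono : ∀ i j, StrictMonoOn (g i j) (Ici 0)
  g_cont : ∀ i j, ContinuousOn (g i j) (Ici 0)

/-- The shape of the transmit power constraints: `L i` constraints in cell `i`, with weighting
matrices `Q i k`, and the extent `delta` to which the distortions consume extra power.
The power limits `q i k` are kept separate. -/
structure PowerShape (N Nt : ℕ) where
  L : Fin N → ℕ
  Q : (i : Fin N) → Fin (L i) → Matrix (Fin Nt) (Fin Nt) ℂ
  delta : ℝ
  Q_posSemidef : ∀ i k, (Q i k).PosSemidef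
  Q_sum_posDef : ∀ i, (∑ k, Q i k).PosDef
  delta_mem : delta ∈ Icc (0 : ℝ) 1

/-- The power limits of a family of power constraints. -/
abbrev PowerShape.Limits {N Nt : ℕ} (P : PowerShape N Nt) : Type :=
  (i : Fin N) → Fin (P.L i) → ℝ

/-- A choice of beamforming vectors, `W i j` being the vector used for user `j` of cell `i`. -/
abbrev Beamforming (N K Nt : ℕ) : Type := Fin N → Fin K → EuclideanSpace ℂ (Fin Nt)

noncomputable section

/-- The combined beamforming matrix of a cell, with the beamforming vectors as columns. -/
def beamMatrix {K Nt : ℕ} (w : Fin K → EuclideanSpace ℂ (Fin Nt)) :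
    Matrix (Fin Nt) (Fin K) ℂ :=
  Matrix.of fun n k => w k n

/-- The Frobenius norm of a complex matrix. -/
def frobNorm {a b : ℕ} (A : Matrix (Fin a) (Fin b) ℂ) : ℝ :=
  Real.sqrt (∑ i, ∑ j, ‖A i j‖ ^ 2)

/-- The matrix that picks out antenna `n`. -/
def antennaMatrix {Nt : ℕ} (n : Fin Nt) : Matrix (Fin Nt) (Fin Nt) ℂ :=
  Matrix.diagonal fun r => if r = n then 1 else 0

/-- The squared norm of the row vector `hᴴ W` for the channel vector `h`. -/
def rowPower {K Nt : ℕ} (h : EuclideanSpace ℂ (Fin Nt))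
    (w : Fin K → EuclideanSpace ℂ (Fin Nt)) : ℝ :=
  ∑ k, ‖inner ℂ h (w k)‖ ^ 2

/-- The power `p` of a user's beamforming vector `w = √p v`, `‖v‖ = 1`. -/
def userPower {N K Nt : ℕ} (W : Beamforming N K Nt) (i : Fin N) (j : Fin K) : ℝ :=
  ‖W i j‖ ^ 2

namespace DownlinkSystem

variable {N K Nt : ℕ} (S : DownlinkSystem N K Nt)

/-- The covariance matrix of the transmitter distortion at a base station that uses the
beamforming vectors `w`. -/
def distortionCov (w : Fin K → EuclideanSpace ℂ (Fin Nt)) : Matrix (Fin Nt) (Fin Nt) ℂ :=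
  Matrix.diagonal fun n => ((S.eta (frobNorm (antennaMatrix n * beamMatrix w)) ^ 2 : ℝ) : ℂ)

/-- The noise and receiver distortion power at user `j` of cell `i`. -/
def receiverNoise (W : Beamforming N K Nt) (i : Fin N) (j : Fin K) : ℝ :=
  S.noise + S.nu (Real.sqrt (∑ m, rowPower (S.h m i j) (W m))) ^ 2

/-- Interference, transmitter distortion, receiver distortion and noise at user `j` of
cell `i`. -/
def interferencePlusNoise (W : Beamforming N K Nt) (i : Fin N) (j : Fin K) : ℝ :=
  ∑ l ∈ Finset.univ.erase j, ‖inner ℂ (S.h i i j) (W i l)‖ ^ 2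
    + ∑ m ∈ Finset.univ.erase i, rowPower (S.h m i j) (W m)
    + ∑ m, (star (S.h m i j).ofLp ⬝ᵥ (S.distortionCov (W m) *ᵥ (S.h m i j).ofLp)).re
    + S.receiverNoise W i j

/-- The signal-to-interference-and-noise ratio of user `j` of cell `i`. -/
def sinr (W : Beamforming N K Nt) (i : Fin N) (j : Fin K) : ℝ :=
  ‖inner ℂ (S.h i i j) (W i j)‖ ^ 2 / S.interferencePlusNoise W i j

/-- The performance of user `j` of cell `i`. -/
def performance (W : Beamforming N K Nt) (i : Fin N) (j : Fin K) : ℝ :=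
  S.g i j (S.sinr W i j)

/-- The power consumed by cell `i` with respect to its `k`-th power constraint. -/
def consumedPower (P : PowerShape N Nt) (W : Beamforming N K Nt) (i : Fin N)
    (k : Fin (P.L i)) : ℝ :=
  (Matrix.trace ((beamMatrix (W i))ᴴ * P.Q i k * beamMatrix (W i))).re
    + (Matrix.trace (((P.delta : ℂ) • P.Q i k) * S.distortionCov (W i))).re

/-- `(β, W)` satisfies the constraints of problem (P1): every user reaches its QoS level `γ`, and
all power constraints hold with their limits scaled by `β`. -/
def IsFeasibleQoS (P : PowerShape N Nt) (q : P.Limits) (γ : Fin N → Fin K → ℝ) (β : ℝ)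
    (W : Beamforming N K Nt) : Prop :=
  (∀ i j, γ i j ≤ S.performance W i j) ∧ ∀ i k, S.consumedPower P W i k ≤ β * q i k

/-- `(β, W)` is an optimal solution of problem (P1): minimize the scaling factor `β`. -/
def IsOptimalQoS (P : PowerShape N Nt) (q : P.Limits) (γ : Fin N → Fin K → ℝ) (β : ℝ)
    (W : Beamforming N K Nt) : Prop :=
  S.IsFeasibleQoS P q γ β W ∧ ∀ β' W', S.IsFeasibleQoS P q γ β' W' → β ≤ β'

/-- `W` satisfies the constraints of problem (P2): the power constraints hold, and every user
reaches its lowest acceptable level `a`. -/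
def IsFeasibleFPO (P : PowerShape N Nt) (q : P.Limits) (a : Fin N → Fin K → ℝ)
    (W : Beamforming N K Nt) : Prop :=
  (∀ i k, S.consumedPower P W i k ≤ q i k) ∧ ∀ i j, a i j ≤ S.performance W i j

/-- The objective of problem (P2), the minimum of `(performance - a) / α` over all users. A user
with portion `α = 0` does not enter the minimum (its quotient counts as `+∞`). -/
def fairnessValue (a α : Fin N → Fin K → ℝ) (W : Beamforming N K Nt) : ℝ :=
  ⨅ u : {u : Fin N × Fin K // 0 < α u.1 u.2},
    (S.performance W u.1.1 u.1.2 - a u.1.1 u.1.2) / α u.1.1 u.1.2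

/-- `W` is an optimal solution of problem (P2). -/
def IsOptimalFPO (P : PowerShape N Nt) (q : P.Limits) (a α : Fin N → Fin K → ℝ)
    (W : Beamforming N K Nt) : Prop :=
  S.IsFeasibleFPO P q a W ∧
    ∀ W', S.IsFeasibleFPO P q a W' → S.fairnessValue a α W' ≤ S.fairnessValue a α W

/-- The matrix `∑ₖ λ_{i,k} Q_{i,k} + ∑_{m,l} μ_{m,l} h_{i,m,l} h_{i,m,l}ᴴ + ∑ₙ τ_{i,n} Tₙ`. -/
def structureMatrix (P : PowerShape N Nt) (lam : P.Limits) (mu : Fin N → Fin K → ℝ)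
    (tau : Fin N → Fin Nt → ℝ) (i : Fin N) : Matrix (Fin Nt) (Fin Nt) ℂ :=
  ∑ k, (lam i k : ℂ) • P.Q i k
    + ∑ m, ∑ l, (mu m l : ℂ) • Matrix.vecMulVec (S.h i m l).ofLp (star (S.h i m l).ofLp)
    + ∑ n, (tau i n : ℂ) • antennaMatrix n

/-- The vector `M⁻¹ h_{i,i,j}`, where `M` is the structure matrix of cell `i`. -/
def structureVector (P : PowerShape N Nt) (lam : P.Limits) (mu : Fin N → Fin K → ℝ)
    (tau : Fin N → Fin Nt → ℝ) (i : Fin N) (j : Fin K) : EuclideanSpace ℂ (Fin Nt) :=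
  WithLp.toLp 2 ((S.structureMatrix P lam mu tau i)⁻¹ *ᵥ (S.h i i j).ofLp)

/-- The normalized vector `M⁻¹ h_{i,i,j} / ‖M⁻¹ h_{i,i,j}‖`. -/
def structureDirection (P : PowerShape N Nt) (lam : P.Limits) (mu : Fin N → Fin K → ℝ)
    (tau : Fin N → Fin Nt → ℝ) (i : Fin N) (j : Fin K) : EuclideanSpace ℂ (Fin Nt) :=
  ((‖S.structureVector P lam mu tau i j‖⁻¹ : ℝ) : ℂ) • S.structureVector P lam mu tau i j

/-- For some parameters in `[0,1]` with invertible (positive definite) structure matrices, every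
beamforming vector is `√p` times the corresponding normalized vector, up to the phase factor
`c i j`. -/
def HasStructure (P : PowerShape N Nt) (W : Beamforming N K Nt) (c : Fin N → Fin K → ℂ) : Prop :=
  ∃ (lam : P.Limits) (mu : Fin N → Fin K → ℝ) (tau : Fin N → Fin Nt → ℝ),
    (∀ i k, lam i k ∈ Icc (0 : ℝ) 1) ∧ (∀ m l, mu m l ∈ Icc (0 : ℝ) 1) ∧
    (∀ i n, tau i n ∈ Icc (0 : ℝ) 1) ∧
    (∀ i, (S.structureMatrix P lam mu tau i).PosDef) ∧
    ∀ i j, W i j =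
      (c i j * (Real.sqrt (userPower W i j) : ℂ)) • S.structureDirection P lam mu tau i j

end DownlinkSystem

/-- `x / f x → 0` as `x → ∞`, the quotients being defined for all large `x`. -/
def GrowsFasterThanLinear (f : ℝ → ℝ) : Prop :=
  (∀ᶠ x in atTop, f x ≠ 0) ∧ Tendsto (fun x => x / f x) atTop (𝓝 0)

end

/-!
The theorem rests on one property shared by the optimal solutions of both problems. Call a
beamforming `W` *unimprovable* under power limits (`DownlinkSystem.Unimprovable`) if no beamforming
within these limits gives a larger SINR to every user that has a positive SINR under `W`. A
violation can be perturbed into a beamforming that is better for all users and has slack in all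
power constraints (`exists_strict_improvement`), so every optimal solution of (P2), and every
nonzero optimal solution of (P1), is unimprovable. Existence of optimal solutions is compactness.

*Structure.* Neither the problem nor `ν` need be convex. Near `W`, freeze the receiver distortion by
keeping the received power of each served user from growing, and replace `η` by its chord from `0`
to the present antenna amplitude (to amplitude one for an idle antenna); by convexity the chord lies
above `η` for smaller amplitudes, and it agrees with `η` at `W`. All constraints then become quadratic forms that are exact at `W`, and
decreasing all of them strictly would improve `W`. Hence no direction decreases all of them to first
order, and Gordan's alternative gives nonnegative multipliers with
`M_i w_{i,j} = ρ_{i,j} h_{i,i,j}` (`Unimprovable.exists_multipliers`). Testing the combination with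
`W` itself shows that some SINR has a positive multiplier; since all channel entries are nonzero and
chord slopes are positive, every antenna then enters `M_i` with a positive weight, so `M_i` is
positive definite. Phase factors change neither performance nor power and can be rotated away.

*Bounded power.* If `η` is superlinear, scaling a beamforming with a large antenna amplitude down to
amplitude one improves all served users (`exists_antennaAmp_le_of_eta`). If `η` is convex and `ν`
superlinear, a positive rate demand in (P1) bounds the received power of that user, hence the
transmitter distortion it may see, hence all amplitudes (`exists_antennaAmp_le_of_nu`). For (P2) no
rate needs to be bounded below, and the structure is used: over all positive definite `M` in a
finitely generated cone of positive semidefinite matrices, the solutions of `M x = ρ h` satisfy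
`‖x‖ ≤ C |⟨h, x⟩|` with one constant `C` (`exists_norm_le_mul_norm_inner`). So a large power means a
large received signal, for which `ν` makes the SINR small, and resetting all diverging powers to one
is an improvement (`exists_userPower_le_of_nu`).
-/

noncomputable section

/-! ### Hermitian forms -/

/-- The real part of the sesquilinear form `xᴴ A y`. -/
def reForm {n : ℕ} (A : Matrix (Fin n) (Fin n) ℂ) (x y : EuclideanSpace ℂ (Fin n)) : ℝ :=
  (star x.ofLp ⬝ᵥ (A *ᵥ y.ofLp)).re

/-- The rank-one matrix `h hᴴ`. -/
def outer {n : ℕ} (h : EuclideanSpace ℂ (Fin n)) : Matrix (Fin n) (Fin n) ℂ :=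
  Matrix.vecMulVec h.ofLp (star h.ofLp)

/-- The diagonal complex matrix with real diagonal entries `d`. -/
def realDiagonal {n : ℕ} (d : Fin n → ℝ) : Matrix (Fin n) (Fin n) ℂ :=
  Matrix.diagonal fun k => (d k : ℂ)

section reForm

variable {n : ℕ} (A B : Matrix (Fin n) (Fin n) ℂ) (x y z : EuclideanSpace ℂ (Fin n))

lemma reForm_add_left : reForm A (x + y) z = reForm A x z + reForm A y z := by
  simp [reForm, add_dotProduct]

lemma reForm_add_right : reForm A x (y + z) = reForm A x y + reForm A x z := by
  simp [reForm, Matrix.mulVec_add, dotProduct_add]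

lemma reForm_smul_left (r : ℝ) : reForm A (r • x) y = r * reForm A x y := by
  have : star (r • x).ofLp = (r : ℂ) • star x.ofLp := by
    ext k; simp
  rw [reForm, this, smul_dotProduct, smul_eq_mul, Complex.re_ofReal_mul, reForm]

lemma reForm_smul_right (r : ℝ) : reForm A x (r • y) = r * reForm A x y := by
  have : (r • y).ofLp = (r : ℂ) • y.ofLp := by
    ext k; simp
  rw [reForm, this, Matrix.mulVec_smul, dotProduct_smul, smul_eq_mul, Complex.re_ofReal_mul,
    reForm]

lemma reForm_matrix_add : reForm (A + B) x y = reForm A x y + reForm B x y := by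
  simp [reForm, Matrix.add_mulVec, dotProduct_add]

lemma reForm_matrix_sub : reForm (A - B) x y = reForm A x y - reForm B x y := by
  simp [reForm, Matrix.sub_mulVec, dotProduct_sub]

lemma reForm_matrix_smul (r : ℝ) : reForm ((r : ℂ) • A) x y = r * reForm A x y := by
  rw [reForm, Matrix.smul_mulVec, dotProduct_smul, smul_eq_mul, Complex.re_ofReal_mul, reForm]

@[simp] lemma reForm_matrix_zero : reForm (0 : Matrix (Fin n) (Fin n) ℂ) x y = 0 := by
  simp [reForm]

lemma reForm_matrix_sum {ι : Type*} (s : Finset ι) (F : ι → Matrix (Fin n) (Fin n) ℂ) :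
    reForm (∑ c ∈ s, F c) x y = ∑ c ∈ s, reForm (F c) x y := by
  simp [reForm, Matrix.sum_mulVec, dotProduct_sum]

variable {A} in
lemma reForm_comm (hA : A.IsHermitian) : reForm A x y = reForm A y x := by
  have h1 : star (star x.ofLp ⬝ᵥ (A *ᵥ y.ofLp)) = star y.ofLp ⬝ᵥ (A *ᵥ x.ofLp) := by
    rw [Matrix.star_dotProduct, star_star, Matrix.star_mulVec, hA.eq, Matrix.dotProduct_mulVec,
      dotProduct_comm]
  rw [reForm, reForm, ← h1]
  simp

lemma inner_eq_dotProduct (h : EuclideanSpace ℂ (Fin n)) :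
    inner ℂ h x = star h.ofLp ⬝ᵥ x.ofLp := by
  rw [EuclideanSpace.inner_eq_star_dotProduct, dotProduct_comm]

lemma outer_mulVec (h : EuclideanSpace ℂ (Fin n)) :
    outer h *ᵥ x.ofLp = (inner ℂ h x : ℂ) • h.ofLp := by
  rw [outer, Matrix.vecMulVec_mulVec, inner_eq_dotProduct]
  ext k; simp [mul_comm]

lemma reForm_outer_self (h : EuclideanSpace ℂ (Fin n)) :
    reForm (outer h) x x = ‖(inner ℂ h x : ℂ)‖ ^ 2 := by
  rw [reForm, outer_mulVec, dotProduct_smul, ← inner_eq_dotProduct,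
    ← inner_conj_symm x h, smul_eq_mul, Complex.mul_conj, Complex.normSq_eq_norm_sq,
    Complex.ofReal_re]

lemma reForm_realDiagonal_self (d : Fin n → ℝ) :
    reForm (realDiagonal d) x x = ∑ k, d k * ‖x k‖ ^ 2 := by
  simp only [reForm, realDiagonal, dotProduct, Matrix.mulVec_diagonal, Complex.re_sum]
  refine Finset.sum_congr rfl fun k _ => ?_
  have : star x.ofLp k * ((d k : ℂ) * x.ofLp k) = (d k : ℂ) * (x.ofLp k * star (x.ofLp k)) := by
    simp only [Pi.star_apply]; ring
  rw [this, Complex.star_def, Complex.mul_conj, Complex.normSq_eq_norm_sq, ← Complex.ofReal_mul,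
    Complex.ofReal_re]

lemma antennaMatrix_eq (k : Fin n) :
    antennaMatrix k = realDiagonal fun r => if r = k then 1 else 0 := by
  unfold antennaMatrix realDiagonal; congr 1; ext r; split_ifs with h <;> simp [h]

lemma reForm_antennaMatrix_self (k : Fin n) : reForm (antennaMatrix k) x x = ‖x k‖ ^ 2 := by
  rw [antennaMatrix_eq, reForm_realDiagonal_self]; simp

variable {A} in
lemma reForm_self_nonneg (hA : A.PosSemidef) : 0 ≤ reForm A x x :=
  (Complex.le_def.1 (hA.dotProduct_mulVec_nonneg x.ofLp)).1

variable {A x} in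
lemma reForm_self_pos (hA : A.PosDef) (hx : x ≠ 0) : 0 < reForm A x x := by
  have : x.ofLp ≠ 0 := fun h => hx (by ext k; simp [h])
  exact (Complex.lt_def.1 (hA.dotProduct_mulVec_pos this)).1

@[fun_prop] lemma continuous_reForm {X : Type*} [TopologicalSpace X]
    {f g : X → EuclideanSpace ℂ (Fin n)} (hf : Continuous f) (hg : Continuous g) :
    Continuous fun t => reForm A (f t) (g t) := by
  unfold reForm dotProduct Matrix.mulVec dotProduct
  simp only [Pi.star_apply]
  fun_prop

variable {A} in
lemma exists_pos_mul_sq_le_reForm (hA : A.PosDef) :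
    ∃ c > 0, ∀ x : EuclideanSpace ℂ (Fin n), c * ‖x‖ ^ 2 ≤ reForm A x x := by
  by_cases hs : (Metric.sphere (0 : EuclideanSpace ℂ (Fin n)) 1).Nonempty
  · obtain ⟨u, hu, hmin⟩ := (isCompact_sphere (0 : EuclideanSpace ℂ (Fin n)) 1).exists_isMinOn hs
      (f := fun x => reForm A x x) (by fun_prop)
    have hu0 : u ≠ 0 := by rintro rfl; simp at hu
    refine ⟨_, reForm_self_pos hA hu0, fun x => ?_⟩
    rcases eq_or_ne x 0 with rfl | hx
    · simp [reForm]
    have hx' : ‖x‖ ≠ 0 := norm_ne_zero_iff.2 hx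
    have h1 := hmin (a := (‖x‖⁻¹ : ℝ) • x) (by simp [norm_smul, hx'])
    simp only [mem_ofPred_eq, reForm_smul_left, reForm_smul_right] at h1
    calc reForm A u u * ‖x‖ ^ 2 ≤ ‖x‖⁻¹ * (‖x‖⁻¹ * reForm A x x) * ‖x‖ ^ 2 := by gcongr
      _ = reForm A x x := by field_simp
  · refine ⟨1, one_pos, fun x => ?_⟩
    have hx : x = 0 := by
      by_contra hx
      exact hs ⟨(‖x‖⁻¹ : ℝ) • x, by simp [norm_smul, hx]⟩
    simp [hx, reForm]

end reForm

/-! ### Antenna amplitudes, SINR and consumed power -/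

/-- The magnitude transmitted at antenna `n`, i.e. the norm of row `n` of the beamforming
matrix. -/
def antennaAmp {K Nt : ℕ} (w : Fin K → EuclideanSpace ℂ (Fin Nt)) (n : Fin Nt) : ℝ :=
  Real.sqrt (∑ k, ‖w k n‖ ^ 2)

section antennaAmp

variable {K Nt : ℕ} (w : Fin K → EuclideanSpace ℂ (Fin Nt)) (n : Fin Nt)

lemma antennaAmp_nonneg : 0 ≤ antennaAmp w n := Real.sqrt_nonneg _

lemma antennaAmp_sq : antennaAmp w n ^ 2 = ∑ k, ‖w k n‖ ^ 2 :=
  Real.sq_sqrt (Finset.sum_nonneg fun _ _ => by positivity)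

lemma frobNorm_antennaMatrix_mul : frobNorm (antennaMatrix n * beamMatrix w) = antennaAmp w n := by
  unfold frobNorm antennaAmp antennaMatrix beamMatrix
  congr 1
  rw [Finset.sum_eq_single n]
  · simp [Matrix.diagonal_mul]
  · intro b _ hb; simp [Matrix.diagonal_mul, hb]
  · simp

lemma norm_apply_le_antennaAmp (k : Fin K) : ‖w k n‖ ≤ antennaAmp w n :=
  Real.le_sqrt_of_sq_le
    (Finset.single_le_sum (f := fun k => ‖w k n‖ ^ 2) (fun _ _ => by positivity)
      (Finset.mem_univ k))

variable {w n} in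
lemma antennaAmp_le {w' : Fin K → EuclideanSpace ℂ (Fin Nt)} (h : ∀ k, ‖w k n‖ ≤ ‖w' k n‖) :
    antennaAmp w n ≤ antennaAmp w' n := by
  unfold antennaAmp
  gcongr with k
  exact h k

lemma antennaAmp_smul (c : ℝ) (hc : 0 ≤ c) :
    antennaAmp (fun k => c • w k) n = c * antennaAmp w n := by
  unfold antennaAmp
  simp only [PiLp.smul_apply, norm_smul, mul_pow, ← Finset.mul_sum]
  rw [Real.sqrt_mul (by positivity)]
  simp [Real.sqrt_sq hc, abs_of_nonneg hc]

@[fun_prop] lemma continuous_antennaAmp {X : Type*} [TopologicalSpace X]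
    {f : X → Fin K → EuclideanSpace ℂ (Fin Nt)} (hf : Continuous f) :
    Continuous fun t => antennaAmp (f t) n := by
  unfold antennaAmp; fun_prop

lemma norm_sq_le_sum_antennaAmp_sq (k : Fin K) : ‖w k‖ ^ 2 ≤ ∑ n, antennaAmp w n ^ 2 := by
  rw [EuclideanSpace.norm_sq_eq]
  gcongr with n
  exact norm_apply_le_antennaAmp w n k

end antennaAmp

namespace DownlinkSystem

variable {N K Nt : ℕ} (S : DownlinkSystem N K Nt)

/-- The power that the transmitter distortion of a base station with beamforming vectors `w` has
after passing through the channel `h`. -/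
def distortionPower (h : EuclideanSpace ℂ (Fin Nt)) (w : Fin K → EuclideanSpace ℂ (Fin Nt)) : ℝ :=
  ∑ n, ‖h n‖ ^ 2 * S.eta (antennaAmp w n) ^ 2

/-- The total information-bearing power (signal and interference) received by user `j` of
cell `i`. -/
def receivedPower (W : Beamforming N K Nt) (i : Fin N) (j : Fin K) : ℝ :=
  ∑ m, rowPower (S.h m i j) (W m)

lemma distortionPower_nonneg (h : EuclideanSpace ℂ (Fin Nt))
    (w : Fin K → EuclideanSpace ℂ (Fin Nt)) : 0 ≤ S.distortionPower h w :=
  Finset.sum_nonneg fun _ _ => by positivity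

lemma distortionCov_eq (w : Fin K → EuclideanSpace ℂ (Fin Nt)) :
    S.distortionCov w = realDiagonal fun n => S.eta (antennaAmp w n) ^ 2 := by
  simp [distortionCov, realDiagonal, frobNorm_antennaMatrix_mul]

lemma re_distortionCov (h : EuclideanSpace ℂ (Fin Nt)) (w : Fin K → EuclideanSpace ℂ (Fin Nt)) :
    (star h.ofLp ⬝ᵥ (S.distortionCov w *ᵥ h.ofLp)).re = S.distortionPower h w := by
  rw [distortionCov_eq]
  exact (reForm_realDiagonal_self h _).trans (Finset.sum_congr rfl fun _ _ => mul_comm _ _)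

lemma rowPower_nonneg (h : EuclideanSpace ℂ (Fin Nt)) (w : Fin K → EuclideanSpace ℂ (Fin Nt)) :
    0 ≤ rowPower h w := Finset.sum_nonneg fun _ _ => by positivity

lemma signal_le_rowPower (h : EuclideanSpace ℂ (Fin Nt)) (w : Fin K → EuclideanSpace ℂ (Fin Nt))
    (k : Fin K) : ‖(inner ℂ h (w k) : ℂ)‖ ^ 2 ≤ rowPower h w :=
  Finset.single_le_sum (f := fun k => ‖(inner ℂ h (w k) : ℂ)‖ ^ 2) (fun _ _ => by positivity)
    (Finset.mem_univ k)

lemma rowPower_le_receivedPower (W : Beamforming N K Nt) (m i : Fin N) (j : Fin K) :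
    rowPower (S.h m i j) (W m) ≤ S.receivedPower W i j :=
  Finset.single_le_sum (f := fun m => rowPower (S.h m i j) (W m))
    (fun _ _ => rowPower_nonneg _ _) (Finset.mem_univ m)

lemma receivedPower_nonneg (W : Beamforming N K Nt) (i : Fin N) (j : Fin K) :
    0 ≤ S.receivedPower W i j := Finset.sum_nonneg fun _ _ => rowPower_nonneg _ _

lemma signal_le_receivedPower (W : Beamforming N K Nt) (i : Fin N) (j : Fin K) :
    ‖(inner ℂ (S.h i i j) (W i j) : ℂ)‖ ^ 2 ≤ S.receivedPower W i j :=
  (signal_le_rowPower _ _ _).trans (S.rowPower_le_receivedPower W i i j)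

/-- The denominator of the SINR, with the useful signal removed from the total received power. -/
lemma interferencePlusNoise_eq (W : Beamforming N K Nt) (i : Fin N) (j : Fin K) :
    S.interferencePlusNoise W i j = S.receivedPower W i j
      - ‖(inner ℂ (S.h i i j) (W i j) : ℂ)‖ ^ 2
      + ∑ m, S.distortionPower (S.h m i j) (W m)
      + (S.noise + S.nu (Real.sqrt (S.receivedPower W i j)) ^ 2) := by
  have h1 : S.receivedPower W i j = ∑ m ∈ Finset.univ.erase i, rowPower (S.h m i j) (W m)
      + rowPower (S.h i i j) (W i) := (Finset.sum_erase_add _ _ (Finset.mem_univ i)).symm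
  have h2 : rowPower (S.h i i j) (W i)
      = ∑ l ∈ Finset.univ.erase j, ‖(inner ℂ (S.h i i j) (W i l) : ℂ)‖ ^ 2
        + ‖(inner ℂ (S.h i i j) (W i j) : ℂ)‖ ^ 2 :=
    (Finset.sum_erase_add _ _ (Finset.mem_univ j)).symm
  simp only [interferencePlusNoise, re_distortionCov, receiverNoise]
  rw [show ∑ m, rowPower (S.h m i j) (W m) = S.receivedPower W i j from rfl]
  rw [h1, h2]; ring

lemma sum_distortionPower_nonneg (W : Beamforming N K Nt) (i : Fin N) (j : Fin K) :
    0 ≤ ∑ m, S.distortionPower (S.h m i j) (W m) :=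
  Finset.sum_nonneg fun _ _ => S.distortionPower_nonneg _ _

lemma noise_le_interferencePlusNoise (W : Beamforming N K Nt) (i : Fin N) (j : Fin K) :
    S.noise ≤ S.interferencePlusNoise W i j := by
  rw [interferencePlusNoise_eq]
  have h1 := S.signal_le_receivedPower W i j
  have h2 := S.sum_distortionPower_nonneg W i j
  have h3 := sq_nonneg (S.nu (Real.sqrt (S.receivedPower W i j)))
  linarith

lemma interferencePlusNoise_pos (W : Beamforming N K Nt) (i : Fin N) (j : Fin K) :
    0 < S.interferencePlusNoise W i j :=
  S.noise_pos.trans_le (S.noise_le_interferencePlusNoise W i j)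

lemma sinr_nonneg (W : Beamforming N K Nt) (i : Fin N) (j : Fin K) : 0 ≤ S.sinr W i j :=
  div_nonneg (by positivity) (S.interferencePlusNoise_pos W i j).le

lemma sinr_pos_iff (W : Beamforming N K Nt) (i : Fin N) (j : Fin K) :
    0 < S.sinr W i j ↔ (inner ℂ (S.h i i j) (W i j) : ℂ) ≠ 0 := by
  rw [sinr, div_pos_iff_of_pos_right (S.interferencePlusNoise_pos W i j)]
  simp [sq_pos_iff]

lemma consumedPower_eq (P : PowerShape N Nt) (W : Beamforming N K Nt) (i : Fin N)
    (k : Fin (P.L i)) :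
    S.consumedPower P W i k = ∑ j, reForm (P.Q i k) (W i j) (W i j)
      + P.delta * ∑ n, (P.Q i k n n).re * S.eta (antennaAmp (W i) n) ^ 2 := by
  unfold consumedPower
  congr 1
  · rw [Matrix.trace, Complex.re_sum]
    refine Finset.sum_congr rfl fun j _ => ?_
    rw [Matrix.diag_apply, Matrix.mul_assoc, Matrix.mul_apply]
    rfl
  · rw [distortionCov_eq, realDiagonal, Matrix.smul_mul, Matrix.trace_smul, smul_eq_mul, Complex.re_ofReal_mul,
      Matrix.trace, Complex.re_sum]
    congr 1
    refine Finset.sum_congr rfl fun n _ => ?_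
    rw [Matrix.diag_apply, Matrix.mul_diagonal, Complex.re_mul_ofReal]

lemma _root_.PowerShape.Q_diag_re_nonneg (P : PowerShape N Nt) (i : Fin N) (k : Fin (P.L i))
    (n : Fin Nt) : 0 ≤ (P.Q i k n n).re :=
  (Complex.le_def.1 (P.Q_posSemidef i k).diag_nonneg).1

lemma consumedPower_nonneg (P : PowerShape N Nt) (W : Beamforming N K Nt) (i : Fin N)
    (k : Fin (P.L i)) : 0 ≤ S.consumedPower P W i k := by
  rw [consumedPower_eq]
  have h1 := P.delta_mem.1
  refine add_nonneg (Finset.sum_nonneg fun j _ => reForm_self_nonneg _ (P.Q_posSemidef i k))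
    (mul_nonneg h1 (Finset.sum_nonneg fun n _ => ?_))
  exact mul_nonneg (P.Q_diag_re_nonneg i k n) (by positivity)

lemma continuous_eta_antennaAmp (i : Fin N) (n : Fin Nt) :
    Continuous fun W : Beamforming N K Nt => S.eta (antennaAmp (W i) n) :=
  S.eta_cont.comp_continuous (by fun_prop) fun W => antennaAmp_nonneg (W i) n

lemma continuous_receivedPower (i : Fin N) (j : Fin K) :
    Continuous fun W : Beamforming N K Nt => S.receivedPower W i j := by
  unfold receivedPower rowPower; fun_prop

lemma continuous_interferencePlusNoise (i : Fin N) (j : Fin K) :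
    Continuous fun W : Beamforming N K Nt => S.interferencePlusNoise W i j := by
  simp only [interferencePlusNoise_eq, distortionPower]
  have h1 := S.continuous_receivedPower i j
  have h2 : Continuous fun W : Beamforming N K Nt => S.nu (Real.sqrt (S.receivedPower W i j)) :=
    S.nu_cont.comp_continuous (by fun_prop) fun W => Real.sqrt_nonneg _
  have h3 := S.continuous_eta_antennaAmp (K := K)
  fun_prop

lemma continuous_sinr (i : Fin N) (j : Fin K) :
    Continuous fun W : Beamforming N K Nt => S.sinr W i j :=
  Continuous.div (by fun_prop) (S.continuous_interferencePlusNoise i j)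
    fun W => (S.interferencePlusNoise_pos W i j).ne'

lemma continuous_performance (i : Fin N) (j : Fin K) :
    Continuous fun W : Beamforming N K Nt => S.performance W i j :=
  (S.g_cont i j).comp_continuous (S.continuous_sinr i j) fun W => S.sinr_nonneg W i j

lemma continuous_consumedPower (P : PowerShape N Nt) (i : Fin N) (k : Fin (P.L i)) :
    Continuous fun W : Beamforming N K Nt => S.consumedPower P W i k := by
  simp only [consumedPower_eq]
  have h3 := S.continuous_eta_antennaAmp (K := K)
  fun_prop

lemma performance_lt_performance {W W' : Beamforming N K Nt} {i : Fin N} {j : Fin K}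
    (h : S.sinr W i j < S.sinr W' i j) : S.performance W i j < S.performance W' i j :=
  S.g_strictMono i j (S.sinr_nonneg W i j) (S.sinr_nonneg W' i j) h

lemma performance_nonneg (W : Beamforming N K Nt) (i : Fin N) (j : Fin K) :
    0 ≤ S.performance W i j := by
  rw [← S.g_zero i j]
  exact (S.g_strictMono i j).monotoneOn self_mem_Ici (S.sinr_nonneg W i j) (S.sinr_nonneg W i j)

lemma performance_pos_iff (W : Beamforming N K Nt) (i : Fin N) (j : Fin K) :
    0 < S.performance W i j ↔ 0 < S.sinr W i j := by
  have h := (S.g_strictMono i j).lt_iff_lt self_mem_Ici (S.sinr_nonneg W i j)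
  rwa [S.g_zero] at h

end DownlinkSystem

namespace DownlinkSystem

variable {N K Nt : ℕ} (S : DownlinkSystem N K Nt)

/-! ### Optimal solutions cannot be improved for all served users -/

/-- No beamforming within the power limits `lim` gives every user with a positive SINR a strictly
larger SINR. -/
def Unimprovable (P : PowerShape N Nt) (lim : P.Limits) (W : Beamforming N K Nt) : Prop :=
  ∀ W' : Beamforming N K Nt, (∀ i j, 0 < S.sinr W i j → S.sinr W i j < S.sinr W' i j) →
    ¬ ∀ i k, S.consumedPower P W' i k ≤ lim i k

variable {S}

lemma eta_mono {x y : ℝ} (hx : 0 ≤ x) (hxy : x ≤ y) : S.eta x ≤ S.eta y :=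
  S.eta_strictMono.monotoneOn hx (hx.trans hxy) hxy

lemma eta_pos (h0 : S.eta 0 = 0) {x : ℝ} (hx : 0 < x) : 0 < S.eta x := by
  rw [← h0]; exact S.eta_strictMono self_mem_Ici hx.le hx

lemma consumedPower_le_of_amp_le {P : PowerShape N Nt} {W W' : Beamforming N K Nt} {i : Fin N}
    {k : Fin (P.L i)} (h1 : ∑ j, reForm (P.Q i k) (W i j) (W i j)
      ≤ ∑ j, reForm (P.Q i k) (W' i j) (W' i j))
    (h2 : ∀ n, antennaAmp (W i) n ≤ antennaAmp (W' i) n) :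
    S.consumedPower P W i k ≤ S.consumedPower P W' i k := by
  rw [consumedPower_eq, consumedPower_eq]
  refine add_le_add h1 (mul_le_mul_of_nonneg_left (Finset.sum_le_sum fun n _ => ?_) P.delta_mem.1)
  refine mul_le_mul_of_nonneg_left ?_ (P.Q_diag_re_nonneg i k n)
  exact pow_le_pow_left₀ (S.eta_nonneg _ (antennaAmp_nonneg _ _))
    (S.eta_mono (antennaAmp_nonneg _ _) (h2 n)) 2

/-- Scaling down a beamforming makes every power constraint strict. -/
lemma consumedPower_smul_lt (h0 : S.eta 0 = 0) {P : PowerShape N Nt} {W : Beamforming N K Nt}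
    {i : Fin N} {k : Fin (P.L i)} {r θ : ℝ} (hr : 0 < r) (hle : S.consumedPower P W i k ≤ r)
    (hθ0 : 0 ≤ θ) (hθ1 : θ < 1) : S.consumedPower P (θ • W) i k < r := by
  have hamp : ∀ n, antennaAmp ((θ • W) i) n = θ * antennaAmp (W i) n := fun n =>
    antennaAmp_smul (W i) n θ hθ0
  have hQ : ∑ j, reForm (P.Q i k) ((θ • W) i j) ((θ • W) i j)
      = θ ^ 2 * ∑ j, reForm (P.Q i k) (W i j) (W i j) := by
    rw [Finset.mul_sum]
    refine Finset.sum_congr rfl fun j _ => ?_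
    rw [Pi.smul_apply, Pi.smul_apply, reForm_smul_left, reForm_smul_right]; ring
  have hQ0 : 0 ≤ ∑ j, reForm (P.Q i k) (W i j) (W i j) :=
    Finset.sum_nonneg fun j _ => reForm_self_nonneg _ (P.Q_posSemidef i k)
  have hθ2 : θ ^ 2 < 1 := by nlinarith
  have hterm : ∀ n, (P.Q i k n n).re * S.eta (antennaAmp ((θ • W) i) n) ^ 2
      ≤ (P.Q i k n n).re * S.eta (antennaAmp (W i) n) ^ 2 := fun n => by
    refine mul_le_mul_of_nonneg_left ?_ (P.Q_diag_re_nonneg i k n)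
    rw [hamp]
    have ha := antennaAmp_nonneg (W i) n
    exact pow_le_pow_left₀ (S.eta_nonneg _ (by positivity))
      (S.eta_mono (by positivity) (by nlinarith)) 2
  have hsum := Finset.sum_le_sum fun n (_ : n ∈ Finset.univ) => hterm n
  have hδ := P.delta_mem.1
  rw [consumedPower_eq] at hle ⊢
  rw [hQ]
  have hdist := mul_le_mul_of_nonneg_left hsum hδ
  rcases hQ0.eq_or_lt with hz | hpos
  · rw [← hz] at hle ⊢
    by_cases hn : ∃ n, 0 < P.delta * ((P.Q i k n n).re * S.eta (antennaAmp (W i) n) ^ 2)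
    · obtain ⟨n, hn⟩ := hn
      have h1 : 0 < P.delta := hδ.lt_of_ne' fun h => by simp [h] at hn
      have h2 : 0 < (P.Q i k n n).re :=
        (P.Q_diag_re_nonneg i k n).lt_of_ne' fun h => by simp [h] at hn
      have h3 : 0 < antennaAmp (W i) n :=
        (antennaAmp_nonneg _ _).lt_of_ne' fun h => by simp [h, h0] at hn
      have h4 : S.eta (antennaAmp ((θ • W) i) n) < S.eta (antennaAmp (W i) n) := by
        rw [hamp]
        exact S.eta_strictMono (mem_Ici.2 (by positivity)) h3.le (by nlinarith)
      have h5 : ∑ n, (P.Q i k n n).re * S.eta (antennaAmp ((θ • W) i) n) ^ 2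
          < ∑ n, (P.Q i k n n).re * S.eta (antennaAmp (W i) n) ^ 2 := by
        refine Finset.sum_lt_sum (fun n _ => hterm n) ⟨n, Finset.mem_univ n, ?_⟩
        exact mul_lt_mul_of_pos_left
          (pow_lt_pow_left₀ h4 (S.eta_nonneg _ (antennaAmp_nonneg _ _)) two_ne_zero) h2
      nlinarith [mul_lt_mul_of_pos_left h5 h1]
    · push Not at hn
      have : P.delta * ∑ n, (P.Q i k n n).re * S.eta (antennaAmp (W i) n) ^ 2 ≤ 0 := by
        rw [Finset.mul_sum]; exact Finset.sum_nonpos fun n _ => hn n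
      nlinarith
  · nlinarith [mul_lt_mul_of_pos_right hθ2 hpos]

/-- If a beamforming is improvable, there is also a competitor that improves the SINR of *every*
user and leaves slack in all power constraints. -/
lemma exists_strict_improvement (h0 : S.eta 0 = 0) (hh : ∀ i j, S.h i i j ≠ 0)
    {P : PowerShape N Nt} {lim : P.Limits} (hlim : ∀ i k, 0 < lim i k) {W : Beamforming N K Nt}
    (hW : ¬ S.Unimprovable P lim W) :
    ∃ W' : Beamforming N K Nt, (∀ i j, S.sinr W i j < S.sinr W' i j) ∧
      ∀ i k, S.consumedPower P W' i k < lim i k := by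
  unfold Unimprovable at hW
  push Not at hW
  obtain ⟨W₁, hs₁, hp₁⟩ := hW
  -- a slight downscaling creates slack in the power constraints
  obtain ⟨W₂, hs₂, hp₂⟩ : ∃ W' : Beamforming N K Nt,
      (∀ i j, 0 < S.sinr W i j → S.sinr W i j < S.sinr W' i j) ∧
      ∀ i k, S.consumedPower P W' i k < lim i k := by
    have hc : Tendsto (fun θ : ℝ => θ • W₁) (𝓝 1) (𝓝 W₁) := by
      have : Continuous fun θ : ℝ => θ • W₁ := by fun_prop
      simpa using this.tendsto 1
    have hev : ∀ᶠ θ : ℝ in 𝓝 1, ∀ i j, 0 < S.sinr W i j → S.sinr W i j < S.sinr (θ • W₁) i j := by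
      simp only [eventually_all]
      intro i j hij
      exact (((S.continuous_sinr i j).tendsto W₁).comp hc).eventually_const_lt (hs₁ i j hij)
    have hev2 : ∀ᶠ θ : ℝ in 𝓝[<] 1, 0 ≤ θ :=
      (eventually_ge_nhds (zero_lt_one' ℝ)).filter_mono nhdsWithin_le_nhds
    obtain ⟨θ, hθ, hθ0, hθ1⟩ :=
      ((hev.filter_mono nhdsWithin_le_nhds).and (hev2.and self_mem_nhdsWithin)).exists
    exact ⟨θ • W₁, hθ, fun i k => consumedPower_smul_lt h0 (hlim i k) (hp₁ i k) hθ0 hθ1⟩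
  -- a small perturbation serves the remaining users
  let D : Beamforming N K Nt := fun i j =>
    if (inner ℂ (S.h i i j) (W₂ i j) : ℂ) = 0 then S.h i i j else 0
  have hc : Tendsto (fun ε : ℝ => W₂ + ε • D) (𝓝 0) (𝓝 W₂) := by
    have : Continuous fun ε : ℝ => W₂ + ε • D := by fun_prop
    simpa using this.tendsto 0
  have hev : ∀ᶠ ε : ℝ in 𝓝 0, ∀ i j, 0 < S.sinr W i j →
      S.sinr W i j < S.sinr (W₂ + ε • D) i j := by
    simp only [eventually_all]
    intro i j hij
    exact (((S.continuous_sinr i j).tendsto W₂).comp hc).eventually_const_lt (hs₂ i j hij)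
  have hev2 : ∀ᶠ ε : ℝ in 𝓝 0, ∀ i k, S.consumedPower P (W₂ + ε • D) i k < lim i k := by
    simp only [eventually_all]
    intro i k
    exact (((S.continuous_consumedPower P i k).tendsto W₂).comp hc).eventually_lt_const (hp₂ i k)
  obtain ⟨ε, ⟨hε, hεp⟩, hε0⟩ :=
    (((hev.and hev2).filter_mono nhdsWithin_le_nhds).and
      (self_mem_nhdsWithin : Ioi (0 : ℝ) ∈ 𝓝[>] 0)).exists
  refine ⟨W₂ + ε • D, fun i j => ?_, hεp⟩
  by_cases hij : 0 < S.sinr W i j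
  · exact hε i j hij
  · refine (not_lt.1 hij).trans_lt ((S.sinr_pos_iff _ i j).2 ?_)
    have hε0' : ε ≠ 0 := (mem_Ioi.1 hε0).ne'
    by_cases hz : (inner ℂ (S.h i i j) (W₂ i j) : ℂ) = 0
    · simp [D, hz, hε0', hh i j, inner_smul_right_eq_smul]
    · simp [D, hz]

lemma IsOptimalQoS.unimprovable (h0 : S.eta 0 = 0) (hh : ∀ i j, S.h i i j ≠ 0)
    {P : PowerShape N Nt} {q : P.Limits} (hq : ∀ i k, 0 < q i k) {γ : Fin N → Fin K → ℝ} {β : ℝ}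
    (hβ : 0 < β) {W : Beamforming N K Nt} (hW : S.IsOptimalQoS P q γ β W) :
    S.Unimprovable P (fun i k => β * q i k) W := by
  by_contra hc
  obtain ⟨W', hs, hp⟩ := exists_strict_improvement h0 hh (fun i k => mul_pos hβ (hq i k)) hc
  have hev : ∀ᶠ b : ℝ in 𝓝 β, ∀ i k, S.consumedPower P W' i k < b * q i k := by
    simp only [eventually_all]
    intro i k
    have : Tendsto (fun b : ℝ => b * q i k) (𝓝 β) (𝓝 (β * q i k)) :=
      tendsto_id.mul_const _
    exact this.eventually_const_lt (hp i k)
  obtain ⟨b, hb, hbβ⟩ :=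
    ((hev.filter_mono nhdsWithin_le_nhds).and (self_mem_nhdsWithin : Iio β ∈ 𝓝[<] β)).exists
  exact (hW.2 b W' ⟨fun i j => (hW.1.1 i j).trans (S.performance_lt_performance (hs i j)).le,
    fun i k => (hb i k).le⟩).not_gt hbβ

lemma exists_pos_of_sum_eq_one {α : Fin N → Fin K → ℝ} (hsum : ∑ i, ∑ j, α i j = 1) :
    Nonempty {u : Fin N × Fin K // 0 < α u.1 u.2} := by
  by_contra hc
  rw [not_nonempty_iff] at hc
  have : ∑ i, ∑ j, α i j ≤ 0 := Finset.sum_nonpos fun i _ => Finset.sum_nonpos fun j _ =>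
    not_lt.1 fun h => hc.false ⟨(i, j), h⟩
  linarith

lemma IsOptimalFPO.unimprovable (h0 : S.eta 0 = 0) (hh : ∀ i j, S.h i i j ≠ 0)
    {P : PowerShape N Nt} {q : P.Limits} (hq : ∀ i k, 0 < q i k) {a α : Fin N → Fin K → ℝ}
    (hsum : ∑ i, ∑ j, α i j = 1) {W : Beamforming N K Nt} (hW : S.IsOptimalFPO P q a α W) :
    S.Unimprovable P q W := by
  by_contra hc
  obtain ⟨W', hs, hp⟩ := exists_strict_improvement h0 hh hq hc
  have hne := exists_pos_of_sum_eq_one hsum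
  refine (hW.2 W' ⟨fun i k => (hp i k).le, fun i j =>
    (hW.1.2 i j).trans (S.performance_lt_performance (hs i j)).le⟩).not_gt ?_
  obtain ⟨u, hu⟩ := exists_eq_ciInf_of_finite
    (f := fun u : {u : Fin N × Fin K // 0 < α u.1 u.2} =>
      (S.performance W' u.1.1 u.1.2 - a u.1.1 u.1.2) / α u.1.1 u.1.2)
  unfold fairnessValue
  rw [← hu]
  refine (ciInf_le (Set.finite_range _).bddBelow u).trans_lt ?_
  exact div_lt_div_of_pos_right
    (sub_lt_sub_right (S.performance_lt_performance (hs u.1.1 u.1.2)) _) u.2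

/-! ### Existence of optimal solutions -/

lemma sum_reForm_Q_le (P : PowerShape N Nt) (W : Beamforming N K Nt) (i : Fin N) :
    ∑ j, reForm (∑ k, P.Q i k) (W i j) (W i j) ≤ ∑ k, S.consumedPower P W i k := by
  simp only [reForm_matrix_sum]
  rw [Finset.sum_comm]
  refine Finset.sum_le_sum fun k _ => ?_
  rw [consumedPower_eq]
  refine le_add_of_nonneg_right (mul_nonneg P.delta_mem.1 (Finset.sum_nonneg fun n _ => ?_))
  exact mul_nonneg (P.Q_diag_re_nonneg i k n) (by positivity)

variable (S) in
lemma isCompact_consumedPower_le (P : PowerShape N Nt) (lim : P.Limits) :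
    IsCompact {W : Beamforming N K Nt | ∀ i k, S.consumedPower P W i k ≤ lim i k} := by
  refine Metric.isCompact_of_isClosed_isBounded ?_ ?_
  · simp only [Set.ofPred_forall]
    exact isClosed_iInter fun i => isClosed_iInter fun k =>
      isClosed_le (S.continuous_consumedPower P i k) continuous_const
  · choose c hc0 hc using fun i => exists_pos_mul_sq_le_reForm (P.Q_sum_posDef i)
    rw [Bornology.forall_isBounded_image_eval_iff.symm]
    intro i
    rw [Bornology.forall_isBounded_image_eval_iff.symm]
    intro j
    refine (Metric.isBounded_closedBall (x := (0 : EuclideanSpace ℂ (Fin Nt)))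
      (r := Real.sqrt ((∑ k, lim i k) / c i))).subset ?_
    rintro _ ⟨_, ⟨W, hW, rfl⟩, rfl⟩
    rw [mem_closedBall_zero_iff]
    refine Real.le_sqrt_of_sq_le ((le_div_iff₀' (hc0 i)).2 ?_)
    calc c i * ‖W i j‖ ^ 2 ≤ reForm (∑ k, P.Q i k) (W i j) (W i j) := hc i _
      _ ≤ ∑ j, reForm (∑ k, P.Q i k) (W i j) (W i j) :=
        Finset.single_le_sum (f := fun j => reForm (∑ k, P.Q i k) (W i j) (W i j))
          (fun j _ => (by
            have := Matrix.PosDef.posSemidef (P.Q_sum_posDef i)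
            exact reForm_self_nonneg _ this)) (Finset.mem_univ j)
      _ ≤ ∑ k, S.consumedPower P W i k := sum_reForm_Q_le P W i
      _ ≤ ∑ k, lim i k := Finset.sum_le_sum fun k _ => hW i k

lemma _root_.PowerShape.L_pos (hNt : 0 < Nt) (P : PowerShape N Nt) (i : Fin N) : 0 < P.L i := by
  by_contra hc
  have hL : IsEmpty (Fin (P.L i)) := by
    rw [Nat.eq_zero_of_not_pos hc]; infer_instance
  have h := (P.Q_sum_posDef i).diag_pos (i := ⟨0, hNt⟩)
  simp at h

lemma IsFeasibleQoS.nonneg (hN : 0 < N) (hNt : 0 < Nt) {P : PowerShape N Nt} {q : P.Limits}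
    (hq : ∀ i k, 0 < q i k) {γ : Fin N → Fin K → ℝ} {β : ℝ} {W : Beamforming N K Nt}
    (hW : S.IsFeasibleQoS P q γ β W) : 0 ≤ β := by
  have h := hW.2 ⟨0, hN⟩ ⟨0, P.L_pos hNt _⟩
  by_contra hβ
  have h1 := S.consumedPower_nonneg P W ⟨0, hN⟩ ⟨0, P.L_pos hNt _⟩
  have h2 := hq ⟨0, hN⟩ ⟨0, P.L_pos hNt _⟩
  nlinarith

lemma eq_zero_of_consumedPower_nonpos {P : PowerShape N Nt} {W : Beamforming N K Nt}
    (h : ∀ i k, S.consumedPower P W i k ≤ 0) : W = 0 := by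
  funext i j
  by_contra hij
  have h1 := sum_reForm_Q_le (S := S) P W i
  have h2 : ∑ k, S.consumedPower P W i k ≤ 0 := Finset.sum_nonpos fun k _ => h i k
  have h3 : 0 < ∑ j, reForm (∑ k, P.Q i k) (W i j) (W i j) :=
    Finset.sum_pos' (fun j _ => reForm_self_nonneg _ (Matrix.PosDef.posSemidef (P.Q_sum_posDef i)))
      ⟨j, Finset.mem_univ j, reForm_self_pos (P.Q_sum_posDef i) hij⟩
  linarith

lemma exists_isOptimalQoS (hN : 0 < N) (hNt : 0 < Nt) {P : PowerShape N Nt} {q : P.Limits}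
    (hq : ∀ i k, 0 < q i k) {γ : Fin N → Fin K → ℝ} (hf : ∃ β W, S.IsFeasibleQoS P q γ β W) :
    ∃ β W, S.IsOptimalQoS P q γ β W := by
  obtain ⟨β₀, W₀, hf₀⟩ := hf
  have hcl : IsClosed {p : ℝ × Beamforming N K Nt | S.IsFeasibleQoS P q γ p.1 p.2} := by
    simp only [IsFeasibleQoS, Set.ofPred_and, Set.ofPred_forall]
    have h1 := S.continuous_performance
    have h2 := S.continuous_consumedPower (K := K) P
    refine IsClosed.inter ?_ ?_
    · exact isClosed_iInter fun i => isClosed_iInter fun j => isClosed_le (by fun_prop)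
        ((h1 i j).comp continuous_snd)
    · exact isClosed_iInter fun i => isClosed_iInter fun k =>
        isClosed_le ((h2 i k).comp continuous_snd) (by fun_prop)
  have hK := ((isCompact_Icc (a := (0 : ℝ)) (b := β₀)).prod
    (S.isCompact_consumedPower_le (K := K) P fun i k => β₀ * q i k)).inter_right hcl
  obtain ⟨⟨β, W⟩, ⟨hm, hf⟩, hmin⟩ := hK.exists_isMinOn
    ⟨(β₀, W₀), ⟨⟨hf₀.nonneg hN hNt hq, le_rfl⟩, hf₀.2⟩, hf₀⟩
    (f := fun p : ℝ × Beamforming N K Nt => p.1) continuous_fst.continuousOn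
  refine ⟨β, W, hf, fun β' W' hf' => ?_⟩
  rcases le_total β' β₀ with hle | hle
  · exact hmin (a := (β', W')) ⟨⟨⟨hf'.nonneg hN hNt hq, hle⟩, fun i k => (hf'.2 i k).trans
      (mul_le_mul_of_nonneg_right hle (hq i k).le)⟩, hf'⟩
  · exact hm.1.2.trans hle

lemma continuous_fairnessValue {a α : Fin N → Fin K → ℝ} (hsum : ∑ i, ∑ j, α i j = 1) :
    Continuous fun W : Beamforming N K Nt => S.fairnessValue a α W := by
  have hne := exists_pos_of_sum_eq_one hsum
  unfold fairnessValue
  simp only [← Finset.inf'_univ_eq_ciInf]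
  refine Continuous.finset_inf'_apply _ fun u _ => ?_
  have := S.continuous_performance u.1.1 u.1.2
  fun_prop

lemma exists_isOptimalFPO {P : PowerShape N Nt} {q : P.Limits} {a α : Fin N → Fin K → ℝ}
    (hsum : ∑ i, ∑ j, α i j = 1) (hf : ∃ W, S.IsFeasibleFPO P q a W) :
    ∃ W, S.IsOptimalFPO P q a α W := by
  have hcl : IsClosed {W : Beamforming N K Nt | ∀ i j, a i j ≤ S.performance W i j} := by
    simp only [Set.ofPred_forall]
    exact isClosed_iInter fun i => isClosed_iInter fun j =>
      isClosed_le continuous_const (S.continuous_performance i j)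
  obtain ⟨W, hW, hmax⟩ := ((S.isCompact_consumedPower_le (K := K) P q).inter_right hcl
    ).exists_isMaxOn (by obtain ⟨W, h1, h2⟩ := hf; exact ⟨W, h1, h2⟩)
    (continuous_fairnessValue (S := S) (a := a) hsum).continuousOn
  exact ⟨W, ⟨hW.1, hW.2⟩, fun W' hW' => hmax ⟨hW'.1, hW'.2⟩⟩

end DownlinkSystem

/-! ### Gordan's alternative and block quadratic forms -/

/-- **Gordan's alternative**: if no vector makes all functionals of a finite family negative, then
some nontrivial nonnegative combination of them vanishes. -/
lemma exists_nonneg_combination_eq_zero {ι E : Type*} [Fintype ι] [AddCommGroup E] [Module ℝ E]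
    (s : Finset ι) (φ : ι → E →ₗ[ℝ] ℝ) (h : ¬ ∃ D, ∀ c ∈ s, φ c D < 0) :
    ∃ y : ι → ℝ, (∀ c, 0 ≤ y c) ∧ (∀ c ∉ s, y c = 0) ∧ (∃ c, 0 < y c) ∧
      ∀ D, ∑ c, y c * φ c D = 0 := by
  classical
  have hopen : IsOpen {v : ι → ℝ | ∀ c ∈ s, v c < 0} := by
    have : {v : ι → ℝ | ∀ c ∈ s, v c < 0} = ⋂ c ∈ s, {v | v c < 0} := by ext; simp
    rw [this]
    exact isOpen_biInter_finset fun c _ => isOpen_lt (continuous_apply c) continuous_const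
  have hconv : Convex ℝ {v : ι → ℝ | ∀ c ∈ s, v c < 0} := by
    intro v hv w hw a b ha hb hab c hc
    have h1 := hv c hc
    have h2 := hw c hc
    simp only [Pi.add_apply, Pi.smul_apply, smul_eq_mul]
    rcases ha.eq_or_lt with rfl | ha'
    · have : b = 1 := by linarith
      subst this; linarith
    · nlinarith [mul_neg_of_pos_of_neg ha' h1]
  have hdisj : Disjoint {v : ι → ℝ | ∀ c ∈ s, v c < 0} (LinearMap.range (LinearMap.pi φ)) := by
    rw [Set.disjoint_left]
    rintro _ hv ⟨D, rfl⟩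
    exact h ⟨D, fun c hc => hv c hc⟩
  obtain ⟨f, u, hfu, huf⟩ := geometric_hahn_banach_open hconv hopen
    (LinearMap.range (LinearMap.pi φ)).convex hdisj
  have hu0 : u ≤ 0 := by simpa using huf 0 (zero_mem _)
  -- a functional bounded below on a subspace vanishes there
  have hzero : ∀ D, f (LinearMap.pi φ D) = 0 := by
    intro D
    by_contra hne
    have h1 := huf (((u - 1) / f (LinearMap.pi φ D)) • (LinearMap.pi φ D : ι → ℝ))
      (Submodule.smul_mem _ _ (LinearMap.mem_range_self (LinearMap.pi φ) D))
    rw [map_smul, smul_eq_mul, div_mul_cancel₀ _ hne] at h1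
    linarith
  have hrep : ∀ v : ι → ℝ, f v = ∑ c, f (Pi.single c 1) * v c := by
    intro v
    conv_lhs => rw [pi_eq_sum_univ' v]
    rw [map_sum]
    refine Finset.sum_congr rfl fun c _ => ?_
    rw [map_smul, smul_eq_mul, mul_comm]
  have htest : ∀ c (t : ℝ), (c ∈ s → t ≤ 0) →
      t * f (Pi.single c 1) + f (fun _ => -1) < 0 := by
    intro c t ht
    have : f (t • Pi.single c 1 + fun _ => -1) < u := by
      refine hfu _ fun c' hc' => ?_
      by_cases hcc : c' = c
      · subst hcc; simpa using (ht hc').trans_lt one_pos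
      · simp [hcc]
    rw [map_add, map_smul, smul_eq_mul] at this
    linarith
  have hneg : f (fun _ => -1) < 0 := (hfu _ fun c _ => by simp).trans_le hu0
  refine ⟨fun c => f (Pi.single c 1), fun c => ?_, fun c hc => ?_, ?_, fun D => ?_⟩
  · by_contra hlt
    push Not at hlt
    have h1 := htest c (f (fun _ => -1) / f (Pi.single c 1) * -1) fun _ => by
      have := div_pos_of_neg_of_neg hneg hlt
      linarith
    rw [mul_assoc, neg_one_mul, mul_neg, div_mul_cancel₀ _ hlt.ne] at h1
    linarith
  · by_contra hne
    have h1 := htest c (-(f (fun _ => -1)) / f (Pi.single c 1)) fun h => absurd h hc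
    rw [div_mul_cancel₀ _ hne] at h1
    linarith
  · by_contra hc
    push Not at hc
    rw [hrep] at hneg
    have : 0 ≤ ∑ c, f (Pi.single c 1) * -1 :=
      Finset.sum_nonneg fun c _ => by have := hc c; linarith
    linarith
  · have := hzero D
    rw [hrep] at this
    simpa using this

section blockForm

variable {N K Nt : ℕ}

/-- The bilinear form on beamformings given by one matrix for each user. -/
def blockForm (B : Fin N → Fin K → Matrix (Fin Nt) (Fin Nt) ℂ) (V W : Beamforming N K Nt) : ℝ :=
  ∑ i, ∑ j, reForm (B i j) (V i j) (W i j)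

/-- The form `blockForm B` as a linear functional of its first argument. -/
def blockFormLeft (B : Fin N → Fin K → Matrix (Fin Nt) (Fin Nt) ℂ) (W : Beamforming N K Nt) :
    Beamforming N K Nt →ₗ[ℝ] ℝ where
  toFun V := blockForm B V W
  map_add' V V' := by simp [blockForm, reForm_add_left, Finset.sum_add_distrib]
  map_smul' r V := by simp [blockForm, reForm_smul_left, Finset.mul_sum]

lemma blockForm_add_smul {B : Fin N → Fin K → Matrix (Fin Nt) (Fin Nt) ℂ}
    (hB : ∀ i j, (B i j).IsHermitian) (W D : Beamforming N K Nt) (ε : ℝ) :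
    blockForm B (W + ε • D) (W + ε • D)
      = blockForm B W W + ε * (2 * blockForm B D W + ε * blockForm B D D) := by
  simp only [blockForm, Finset.mul_sum, ← Finset.sum_add_distrib]
  refine Finset.sum_congr rfl fun i _ => Finset.sum_congr rfl fun j _ => ?_
  simp only [Pi.add_apply, Pi.smul_apply, reForm_add_left, reForm_add_right, reForm_smul_left,
    reForm_smul_right, reForm_comm (W i j) (D i j) (hB i j)]
  ring

lemma eventually_blockForm_lt {B : Fin N → Fin K → Matrix (Fin Nt) (Fin Nt) ℂ}
    (hB : ∀ i j, (B i j).IsHermitian) {W D : Beamforming N K Nt} (h : blockForm B D W < 0) :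
    ∀ᶠ ε : ℝ in 𝓝[>] 0, blockForm B (W + ε • D) (W + ε • D) < blockForm B W W := by
  have h1 : Tendsto (fun ε : ℝ => 2 * blockForm B D W + ε * blockForm B D D) (𝓝 0)
      (𝓝 (2 * blockForm B D W + 0 * blockForm B D D)) :=
    Continuous.tendsto (by fun_prop) 0
  have h2 := (h1.eventually_lt_const (u := 0) (by linarith)).filter_mono
    (nhdsWithin_le_nhds (s := Ioi 0))
  filter_upwards [h2, self_mem_nhdsWithin] with ε hε hε0
  rw [blockForm_add_smul hB]
  linarith [mul_neg_of_pos_of_neg (mem_Ioi.1 hε0) hε]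

end blockForm

section realDiagonal

variable {n : ℕ}

lemma realDiagonal_add (d e : Fin n → ℝ) :
    realDiagonal (fun k => d k + e k) = realDiagonal d + realDiagonal e := by
  simp [realDiagonal, Matrix.diagonal_add]

lemma sum_smul_realDiagonal {ι : Type*} (s : Finset ι) (y : ι → ℝ) (d : ι → Fin n → ℝ) :
    ∑ c ∈ s, (y c : ℂ) • realDiagonal (d c) = realDiagonal fun k => ∑ c ∈ s, y c * d c k := by
  ext k l
  simp only [Matrix.sum_apply, Matrix.smul_apply, realDiagonal, Matrix.diagonal_apply]
  by_cases hkl : k = l <;> simp [hkl]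

lemma sum_smul_antennaMatrix (d : Fin n → ℝ) :
    ∑ k, (d k : ℂ) • antennaMatrix k = realDiagonal d := by
  ext k l
  simp only [Matrix.sum_apply, Matrix.smul_apply, realDiagonal, antennaMatrix,
    Matrix.diagonal_apply]
  by_cases hkl : k = l <;> simp [hkl]

lemma isHermitian_realDiagonal (d : Fin n → ℝ) : (realDiagonal d).IsHermitian := by
  rw [realDiagonal, Matrix.isHermitian_diagonal_iff]
  intro k; simp [isSelfAdjoint_iff]

lemma posDef_realDiagonal {d : Fin n → ℝ} (hd : ∀ k, 0 < d k) : (realDiagonal d).PosDef := by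
  rw [realDiagonal, Matrix.posDef_diagonal_iff]
  intro k; exact_mod_cast hd k

lemma posSemidef_outer (h : EuclideanSpace ℂ (Fin n)) : (outer h).PosSemidef :=
  Matrix.posSemidef_vecMulVec_self_star _

lemma mulVec_eq_zero_of_reForm {A : Matrix (Fin n) (Fin n) ℂ} {x : EuclideanSpace ℂ (Fin n)}
    (h : ∀ z, reForm A z x = 0) : A *ᵥ x.ofLp = 0 := by
  have h1 := h (WithLp.toLp 2 (A *ᵥ x.ofLp))
  have h2 : 0 ≤ star (A *ᵥ x.ofLp) ⬝ᵥ (A *ᵥ x.ofLp) := dotProduct_star_self_nonneg _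
  rw [← dotProduct_star_self_eq_zero (v := A *ᵥ x.ofLp)]
  exact Complex.ext h1 (Complex.le_def.1 h2).2.symm

end realDiagonal

/-! ### Stationarity of unimprovable beamformings -/

lemma ConvexOn.le_div_mul {f : ℝ → ℝ} (hf : ConvexOn ℝ (Ici 0) f) (h0 : f 0 = 0) {b t : ℝ}
    (hb : 0 < b) (ht : 0 ≤ t) (htb : t ≤ b) : f t ≤ f b / b * t := by
  have h := hf.2 (mem_Ici.2 hb.le) (self_mem_Ici (a := (0 : ℝ)))
    (show 0 ≤ t / b by positivity) (show 0 ≤ 1 - t / b by rw [sub_nonneg, div_le_one hb]; exact htb) (by ring)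
  simp only [smul_eq_mul, h0, mul_zero, add_zero, div_mul_cancel₀ _ hb.ne'] at h
  calc f t ≤ t / b * f b := h
    _ = f b / b * t := by ring

namespace DownlinkSystem

variable {N K Nt : ℕ} (S : DownlinkSystem N K Nt)

/-- The largest amplitude up to which `distortionSlope` bounds the distortion: the present
amplitude, or `1` for an idle antenna. -/
def amplitudeBound (W : Beamforming N K Nt) (i : Fin N) (n : Fin Nt) : ℝ :=
  if antennaAmp (W i) n = 0 then 1 else antennaAmp (W i) n

/-- The slope of the chord of `η` over `[0, amplitudeBound]`. -/
def distortionSlope (W : Beamforming N K Nt) (i : Fin N) (n : Fin Nt) : ℝ :=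
  S.eta (amplitudeBound W i n) / amplitudeBound W i n

variable {S}

lemma amplitudeBound_pos (W : Beamforming N K Nt) (i : Fin N) (n : Fin Nt) :
    0 < amplitudeBound W i n := by
  unfold amplitudeBound
  split_ifs with h
  · exact one_pos
  · exact (antennaAmp_nonneg _ _).lt_of_ne' h

lemma distortionSlope_pos (h0 : S.eta 0 = 0) (W : Beamforming N K Nt) (i : Fin N) (n : Fin Nt) :
    0 < S.distortionSlope W i n :=
  div_pos (S.eta_pos h0 (amplitudeBound_pos W i n)) (amplitudeBound_pos W i n)

lemma eta_antennaAmp_eq (h0 : S.eta 0 = 0) (W : Beamforming N K Nt) (i : Fin N) (n : Fin Nt) :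
    S.eta (antennaAmp (W i) n) ^ 2
      = S.distortionSlope W i n ^ 2 * antennaAmp (W i) n ^ 2 := by
  rw [← mul_pow]
  congr 1
  unfold distortionSlope amplitudeBound
  split_ifs with h
  · rw [h, h0, mul_zero]
  · rw [div_mul_cancel₀ _ h]

lemma eta_antennaAmp_le (hη : ConvexOn ℝ (Ici 0) S.eta) (h0 : S.eta 0 = 0)
    {W V : Beamforming N K Nt} {i : Fin N} {n : Fin Nt}
    (h : antennaAmp (V i) n ≤ amplitudeBound W i n) :
    S.eta (antennaAmp (V i) n) ^ 2 ≤ S.distortionSlope W i n ^ 2 * antennaAmp (V i) n ^ 2 := by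
  rw [← mul_pow]
  exact pow_le_pow_left₀ (S.eta_nonneg _ (antennaAmp_nonneg _ _))
    (hη.le_div_mul h0 (amplitudeBound_pos W i n) (antennaAmp_nonneg _ _) h) 2

variable (S) in
/-- The matrices of the quadratic majorant of the `k`-th consumed power of cell `a`. -/
def powerBlocks (P : PowerShape N Nt) (W : Beamforming N K Nt) (a : Fin N) (k : Fin (P.L a)) :
    Fin N → Fin K → Matrix (Fin Nt) (Fin Nt) ℂ := fun i _ =>
  if a = i then P.Q a k
    + realDiagonal fun n => P.delta * ((P.Q a k n n).re * S.distortionSlope W a n ^ 2)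
  else 0

/-- The matrices of the quadratic form `‖Tₙ W_a‖²`. -/
def antennaBlocks (K : ℕ) (a : Fin N) (n : Fin Nt) :
    Fin N → Fin K → Matrix (Fin Nt) (Fin Nt) ℂ := fun i _ =>
  if a = i then antennaMatrix n else 0

variable (S) in
/-- The matrices of the total power received by user `l` of cell `m`. -/
def receivedBlocks (m : Fin N) (l : Fin K) :
    Fin N → Fin K → Matrix (Fin Nt) (Fin Nt) ℂ := fun i _ => outer (S.h i m l)

variable (S) in
/-- The matrices of a quadratic majorant of (interference plus transmitter distortion) minus
(signal divided by the present SINR) at user `l` of cell `m`. -/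
def sinrBlocks (W : Beamforming N K Nt) (m : Fin N) (l : Fin K) :
    Fin N → Fin K → Matrix (Fin Nt) (Fin Nt) ℂ := fun i j =>
  outer (S.h i m l) + realDiagonal (fun n => ‖S.h i m l n‖ ^ 2 * S.distortionSlope W i n ^ 2)
    - if m = i ∧ l = j then ((1 + 1 / S.sinr W m l : ℝ) : ℂ) • outer (S.h m m l) else 0

lemma isHermitian_real_smul {n : ℕ} {A : Matrix (Fin n) (Fin n) ℂ} (hA : A.IsHermitian) (r : ℝ) :
    ((r : ℂ) • A).IsHermitian := by
  rw [Matrix.IsHermitian, Matrix.conjTranspose_smul, hA.eq]; simp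

lemma isHermitian_powerBlocks (P : PowerShape N Nt) (W : Beamforming N K Nt) (a : Fin N)
    (k : Fin (P.L a)) (i : Fin N) (j : Fin K) : (S.powerBlocks P W a k i j).IsHermitian := by
  unfold powerBlocks
  split_ifs
  · exact (P.Q_posSemidef a k).isHermitian.add (isHermitian_realDiagonal _)
  · exact Matrix.isHermitian_zero

lemma isHermitian_antennaBlocks (a : Fin N) (n : Fin Nt) (i : Fin N) (j : Fin K) :
    (antennaBlocks K a n i j).IsHermitian := by
  unfold antennaBlocks
  split_ifs
  · rw [antennaMatrix_eq]; exact isHermitian_realDiagonal _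
  · exact Matrix.isHermitian_zero

lemma isHermitian_sinrBlocks (W : Beamforming N K Nt) (m : Fin N) (l : Fin K) (i : Fin N)
    (j : Fin K) : (S.sinrBlocks W m l i j).IsHermitian := by
  unfold sinrBlocks
  refine ((posSemidef_outer _).isHermitian.add (isHermitian_realDiagonal _)).sub ?_
  split_ifs
  · exact isHermitian_real_smul (posSemidef_outer _).isHermitian _
  · exact Matrix.isHermitian_zero

lemma sum_reForm_realDiagonal (d : Fin Nt → ℝ) (w : Fin K → EuclideanSpace ℂ (Fin Nt)) :
    ∑ j, reForm (realDiagonal d) (w j) (w j) = ∑ n, d n * antennaAmp w n ^ 2 := by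
  simp only [reForm_realDiagonal_self, antennaAmp_sq, Finset.mul_sum]
  exact Finset.sum_comm

lemma blockForm_powerBlocks (P : PowerShape N Nt) (W V : Beamforming N K Nt) (a : Fin N)
    (k : Fin (P.L a)) : blockForm (S.powerBlocks P W a k) V V
      = ∑ j, reForm (P.Q a k) (V a j) (V a j) + P.delta *
        ∑ n, (P.Q a k n n).re * (S.distortionSlope W a n ^ 2 * antennaAmp (V a) n ^ 2) := by
  unfold blockForm powerBlocks
  rw [Finset.sum_eq_single a]
  · simp only [if_true, reForm_matrix_add, Finset.sum_add_distrib, sum_reForm_realDiagonal,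
      Finset.mul_sum, mul_assoc]
  · intro i _ hi; simp [hi.symm]
  · simp

lemma blockForm_antennaBlocks (V : Beamforming N K Nt) (a : Fin N) (n : Fin Nt) :
    blockForm (antennaBlocks K a n) V V = antennaAmp (V a) n ^ 2 := by
  unfold blockForm antennaBlocks
  rw [Finset.sum_eq_single a]
  · simp [reForm_antennaMatrix_self, antennaAmp_sq]
  · intro i _ hi; simp [hi.symm]
  · simp

lemma blockForm_receivedBlocks (V : Beamforming N K Nt) (m : Fin N) (l : Fin K) :
    blockForm (S.receivedBlocks m l) V V = S.receivedPower V m l := by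
  simp [blockForm, receivedBlocks, reForm_outer_self, receivedPower, rowPower]

lemma blockForm_sinrBlocks (W V : Beamforming N K Nt) (m : Fin N) (l : Fin K) :
    blockForm (S.sinrBlocks W m l) V V = S.receivedPower V m l
      + ∑ i, ∑ n, ‖S.h i m l n‖ ^ 2 * (S.distortionSlope W i n ^ 2 * antennaAmp (V i) n ^ 2)
      - (1 + 1 / S.sinr W m l) * ‖(inner ℂ (S.h m m l) (V m l) : ℂ)‖ ^ 2 := by
  unfold blockForm sinrBlocks
  simp only [reForm_matrix_sub, reForm_matrix_add, Finset.sum_add_distrib, Finset.sum_sub_distrib,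
    sum_reForm_realDiagonal, reForm_outer_self, mul_assoc]
  congr 1
  rw [Finset.sum_eq_single m, Finset.sum_eq_single l]
  · rw [if_pos ⟨rfl, rfl⟩, reForm_matrix_smul, reForm_outer_self]
  · intro j _ hj; simp [hj.symm]
  · simp
  · intro i _ hi; simp [hi.symm]
  · simp

/-- A competitor with smaller quadratic majorants is better for all served users. -/
lemma sinr_lt_of_blockForm_lt (hη : ConvexOn ℝ (Ici 0) S.eta) (h0 : S.eta 0 = 0)
    {W V : Beamforming N K Nt} {m : Fin N} {l : Fin K} (hs : 0 < S.sinr W m l)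
    (hamp : ∀ i n, antennaAmp (V i) n ≤ amplitudeBound W i n)
    (hrec : S.receivedPower V m l ≤ S.receivedPower W m l)
    (h : blockForm (S.sinrBlocks W m l) V V < blockForm (S.sinrBlocks W m l) W W) :
    S.sinr W m l < S.sinr V m l := by
  rw [blockForm_sinrBlocks, blockForm_sinrBlocks] at h
  have hW := S.interferencePlusNoise_pos W m l
  have hV := S.interferencePlusNoise_pos V m l
  have hsW : 1 / S.sinr W m l * ‖(inner ℂ (S.h m m l) (W m l) : ℂ)‖ ^ 2
      = S.interferencePlusNoise W m l := by
    have hX : ‖(inner ℂ (S.h m m l) (W m l) : ℂ)‖ ^ 2 ≠ 0 := by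
      have := (S.sinr_pos_iff W m l).1 hs
      simpa using this
    rw [sinr, one_div_div, div_mul_cancel₀ _ hX]
  have hdW : ∑ i, ∑ n, ‖S.h i m l n‖ ^ 2 *
      (S.distortionSlope W i n ^ 2 * antennaAmp (W i) n ^ 2)
      = ∑ i, S.distortionPower (S.h i m l) (W i) := by
    simp only [distortionPower, S.eta_antennaAmp_eq h0]
  have hdV : ∑ i, S.distortionPower (S.h i m l) (V i) ≤ ∑ i, ∑ n, ‖S.h i m l n‖ ^ 2 *
      (S.distortionSlope W i n ^ 2 * antennaAmp (V i) n ^ 2) :=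
    Finset.sum_le_sum fun i _ => Finset.sum_le_sum fun n _ =>
      mul_le_mul_of_nonneg_left (S.eta_antennaAmp_le hη h0 (hamp i n)) (by positivity)
  have hν : S.nu (Real.sqrt (S.receivedPower V m l)) ^ 2
      ≤ S.nu (Real.sqrt (S.receivedPower W m l)) ^ 2 :=
    pow_le_pow_left₀ (S.nu_nonneg _ (Real.sqrt_nonneg _))
      (S.nu_mono (Real.sqrt_nonneg _) (Real.sqrt_nonneg _) (Real.sqrt_le_sqrt hrec)) 2
  have hIW := S.interferencePlusNoise_eq W m l
  have hIV := S.interferencePlusNoise_eq V m l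
  have key : S.interferencePlusNoise V m l
      < 1 / S.sinr W m l * ‖(inner ℂ (S.h m m l) (V m l) : ℂ)‖ ^ 2 := by
    linarith
  rw [sinr.eq_1 S V, lt_div_iff₀ hV]
  rwa [one_div, inv_mul_eq_div, lt_div_iff₀ hs, mul_comm] at key

lemma consumedPower_le_blockForm (hη : ConvexOn ℝ (Ici 0) S.eta) (h0 : S.eta 0 = 0)
    {P : PowerShape N Nt} {W V : Beamforming N K Nt}
    (hamp : ∀ i n, antennaAmp (V i) n ≤ amplitudeBound W i n) (a : Fin N) (k : Fin (P.L a)) :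
    S.consumedPower P V a k ≤ blockForm (S.powerBlocks P W a k) V V := by
  rw [consumedPower_eq, blockForm_powerBlocks]
  refine add_le_add_right (mul_le_mul_of_nonneg_left (Finset.sum_le_sum fun n _ => ?_)
    P.delta_mem.1) _
  exact mul_le_mul_of_nonneg_left (S.eta_antennaAmp_le hη h0 (hamp a n))
    (P.Q_diag_re_nonneg a k n)

lemma blockForm_powerBlocks_self (h0 : S.eta 0 = 0) (P : PowerShape N Nt)
    (W : Beamforming N K Nt) (a : Fin N) (k : Fin (P.L a)) :
    blockForm (S.powerBlocks P W a k) W W = S.consumedPower P W a k := by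
  simp only [consumedPower_eq, blockForm_powerBlocks, S.eta_antennaAmp_eq h0]

end DownlinkSystem

namespace DownlinkSystem

variable {N K Nt : ℕ} {S : DownlinkSystem N K Nt}

/-- The indices of the quadratic forms in the stationarity condition: power constraints, antennas,
total received powers and SINRs. -/
abbrev BlockIndex (K : ℕ) (P : PowerShape N Nt) : Type :=
  ((Σ i, Fin (P.L i)) ⊕ (Fin N × Fin Nt)) ⊕ ((Fin N × Fin K) ⊕ (Fin N × Fin K))

variable (S) in
/-- The matrices of the quadratic form with a given index. -/
def blocks (P : PowerShape N Nt) (W : Beamforming N K Nt) :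
    BlockIndex K P → Fin N → Fin K → Matrix (Fin Nt) (Fin Nt) ℂ
  | .inl (.inl p) => S.powerBlocks P W p.1 p.2
  | .inl (.inr a) => antennaBlocks K a.1 a.2
  | .inr (.inl u) => S.receivedBlocks u.1 u.2
  | .inr (.inr u) => S.sinrBlocks W u.1 u.2

variable (S) in
/-- The forms that are relevant at `W`: nonzero consumed powers, active antennas and served
users. -/
def IsActive (P : PowerShape N Nt) (W : Beamforming N K Nt) : BlockIndex K P → Prop
  | .inl (.inl p) => 0 < S.consumedPower P W p.1 p.2
  | .inl (.inr a) => 0 < antennaAmp (W a.1) a.2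
  | .inr (.inl u) => 0 < S.sinr W u.1 u.2
  | .inr (.inr u) => 0 < S.sinr W u.1 u.2

lemma isHermitian_blocks (P : PowerShape N Nt) (W : Beamforming N K Nt) (c : BlockIndex K P)
    (i : Fin N) (j : Fin K) : (S.blocks P W c i j).IsHermitian :=
  match c with
  | .inl (.inl p) => isHermitian_powerBlocks P W p.1 p.2 i j
  | .inl (.inr a) => isHermitian_antennaBlocks a.1 a.2 i j
  | .inr (.inl u) => (posSemidef_outer (S.h i u.1 u.2)).isHermitian
  | .inr (.inr u) => isHermitian_sinrBlocks W u.1 u.2 i j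

/-- At an unimprovable beamforming no direction decreases all active forms to first order. -/
lemma Unimprovable.not_exists_descent (hη : ConvexOn ℝ (Ici 0) S.eta) (h0 : S.eta 0 = 0)
    {P : PowerShape N Nt} {lim : P.Limits} (hlim : ∀ i k, 0 < lim i k) {W : Beamforming N K Nt}
    (hle : ∀ i k, S.consumedPower P W i k ≤ lim i k) (hW : S.Unimprovable P lim W) :
    ¬ ∃ D, ∀ c, S.IsActive P W c → blockForm (S.blocks P W c) D W < 0 := by
  rintro ⟨D, hD⟩
  have hc : Tendsto (fun ε : ℝ => W + ε • D) (𝓝[>] 0) (𝓝 W) := by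
    have : Continuous fun ε : ℝ => W + ε • D := by fun_prop
    simpa using (this.tendsto 0).mono_left nhdsWithin_le_nhds
  have hev1 : ∀ᶠ ε : ℝ in 𝓝[>] 0, ∀ c, S.IsActive P W c →
      blockForm (S.blocks P W c) (W + ε • D) (W + ε • D) < blockForm (S.blocks P W c) W W := by
    simp only [eventually_all]
    exact fun c hcA => eventually_blockForm_lt (isHermitian_blocks P W c) (hD c hcA)
  have hev2 : ∀ᶠ ε : ℝ in 𝓝[>] 0, ∀ i n, antennaAmp (W i) n = 0 →
      antennaAmp ((W + ε • D) i) n < 1 := by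
    simp only [eventually_all]
    intro i n hz
    have hcont : Continuous fun V : Beamforming N K Nt => antennaAmp (V i) n := by fun_prop
    exact ((hcont.tendsto W).comp hc).eventually_lt_const (by rw [hz]; exact one_pos)
  have hev3 : ∀ᶠ ε : ℝ in 𝓝[>] 0, ∀ i k, S.consumedPower P W i k = 0 →
      S.consumedPower P (W + ε • D) i k < lim i k := by
    simp only [eventually_all]
    intro i k hz
    exact (((S.continuous_consumedPower P i k).tendsto W).comp hc).eventually_lt_const
      (by rw [hz]; exact hlim i k)
  obtain ⟨ε, h1, h2, h3⟩ := (hev1.and (hev2.and hev3)).exists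
  have hamp : ∀ i n, antennaAmp ((W + ε • D) i) n ≤ amplitudeBound W i n := by
    intro i n
    unfold amplitudeBound
    split_ifs with hz
    · exact (h2 i n hz).le
    · have h4 := h1 (.inl (.inr (i, n))) ((antennaAmp_nonneg _ _).lt_of_ne' hz)
      simp only [blocks, blockForm_antennaBlocks] at h4
      exact (lt_of_pow_lt_pow_left₀ 2 (antennaAmp_nonneg _ _) h4).le
  refine hW (W + ε • D) (fun i j hij => ?_) fun i k => ?_
  · have h4 := h1 (.inr (.inl (i, j))) hij
    simp only [blocks, blockForm_receivedBlocks] at h4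
    exact sinr_lt_of_blockForm_lt hη h0 hij hamp h4.le (h1 (.inr (.inr (i, j))) hij)
  · rcases (S.consumedPower_nonneg P W i k).eq_or_lt with hz | hpos
    · exact (h3 i k hz.symm).le
    · have h4 := h1 (.inl (.inl ⟨i, k⟩)) hpos
      simp only [blocks, blockForm_powerBlocks_self h0] at h4
      exact (consumedPower_le_blockForm hη h0 hamp i k).trans (h4.le.trans (hle i k))

variable (S) in
/-- The coefficients of the antenna matrices `Tₙ` collected from a combination of the forms. -/
def antennaMultiplier (P : PowerShape N Nt) (W : Beamforming N K Nt) (y : BlockIndex K P → ℝ)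
    (i : Fin N) (n : Fin Nt) : ℝ :=
  ∑ k, y (.inl (.inl ⟨i, k⟩)) * (P.delta * ((P.Q i k n n).re * S.distortionSlope W i n ^ 2))
    + y (.inl (.inr (i, n)))
    + ∑ m, ∑ l, y (.inr (.inr (m, l))) * (‖S.h i m l n‖ ^ 2 * S.distortionSlope W i n ^ 2)

lemma sum_smul_blocks (P : PowerShape N Nt) (W : Beamforming N K Nt) (y : BlockIndex K P → ℝ)
    (i : Fin N) (j : Fin K) :
    ∑ c, (y c : ℂ) • S.blocks P W c i j
      = S.structureMatrix P (fun i k => y (.inl (.inl ⟨i, k⟩)))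
          (fun m l => y (.inr (.inl (m, l))) + y (.inr (.inr (m, l))))
          (S.antennaMultiplier P W y) i
        - ((y (.inr (.inr (i, j))) * (1 + 1 / S.sinr W i j) : ℝ) : ℂ) • outer (S.h i i j) := by
  have e1 : ∑ p : Σ i, Fin (P.L i), (y (.inl (.inl p)) : ℂ) • S.powerBlocks P W p.1 p.2 i j
      = ∑ k, (y (.inl (.inl ⟨i, k⟩)) : ℂ) • P.Q i k + realDiagonal fun n => ∑ k,
        y (.inl (.inl ⟨i, k⟩)) * (P.delta * ((P.Q i k n n).re * S.distortionSlope W i n ^ 2)) := by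
    rw [Fintype.sum_sigma, Finset.sum_eq_single i]
    · simp only [powerBlocks, if_true, smul_add, Finset.sum_add_distrib, sum_smul_realDiagonal]
    · intro a _ ha; simp [powerBlocks, ha]
    · simp
  have e2 : ∑ a : Fin N × Fin Nt, (y (.inl (.inr a)) : ℂ) • antennaBlocks K a.1 a.2 i j
      = realDiagonal fun n => y (.inl (.inr (i, n))) := by
    rw [Fintype.sum_prod_type, Finset.sum_eq_single i]
    · simp only [antennaBlocks, if_true]
      exact sum_smul_antennaMatrix fun n => y (.inl (.inr (i, n)))
    · intro a _ ha; simp [antennaBlocks, ha]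
    · simp
  have e3 : ∑ u : Fin N × Fin K, (y (.inr (.inl u)) : ℂ) • S.receivedBlocks u.1 u.2 i j
      = ∑ m, ∑ l, (y (.inr (.inl (m, l))) : ℂ) • outer (S.h i m l) := by
    rw [Fintype.sum_prod_type]; rfl
  have e4 : ∑ u : Fin N × Fin K, (y (.inr (.inr u)) : ℂ) • S.sinrBlocks W u.1 u.2 i j
      = ∑ m, ∑ l, (y (.inr (.inr (m, l))) : ℂ) • outer (S.h i m l)
        + (realDiagonal fun n => ∑ m, ∑ l,
          y (.inr (.inr (m, l))) * (‖S.h i m l n‖ ^ 2 * S.distortionSlope W i n ^ 2))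
        - ((y (.inr (.inr (i, j))) * (1 + 1 / S.sinr W i j) : ℝ) : ℂ) • outer (S.h i i j) := by
    simp only [sinrBlocks, smul_sub, smul_add, Finset.sum_sub_distrib, Finset.sum_add_distrib]
    congr 1
    · congr 1
      · rw [Fintype.sum_prod_type]
      · rw [sum_smul_realDiagonal]; simp only [Fintype.sum_prod_type]
    · rw [Finset.sum_eq_single (i, j)]
      · rw [if_pos ⟨rfl, rfl⟩, smul_smul, Complex.ofReal_mul]
      · rintro ⟨a, b⟩ _ hab
        rw [if_neg, smul_zero]
        rintro ⟨rfl, rfl⟩; exact hab rfl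
      · simp
  rw [Fintype.sum_sum_type, Fintype.sum_sum_type, Fintype.sum_sum_type]
  simp only [blocks]
  rw [e1, e2, e3, e4, structureMatrix, sum_smul_antennaMatrix]
  have e5 : S.antennaMultiplier P W y i = fun n => (∑ k,
      y (.inl (.inl ⟨i, k⟩)) * (P.delta * ((P.Q i k n n).re * S.distortionSlope W i n ^ 2))
      + y (.inl (.inr (i, n)))) + ∑ m, ∑ l,
      y (.inr (.inr (m, l))) * (‖S.h i m l n‖ ^ 2 * S.distortionSlope W i n ^ 2) := rfl
  rw [e5, realDiagonal_add, realDiagonal_add]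
  simp only [Complex.ofReal_add, add_smul, Finset.sum_add_distrib]
  change _ = _ + (∑ m, ∑ l, _ • outer (S.h i m l) + ∑ m, ∑ l, _ • outer (S.h i m l)) + _ - _
  abel

lemma posSemidef_real_smul {n : ℕ} {A : Matrix (Fin n) (Fin n) ℂ} (hA : A.PosSemidef) {r : ℝ}
    (hr : 0 ≤ r) : ((r : ℂ) • A).PosSemidef :=
  hA.smul (by exact_mod_cast hr)

lemma posDef_structureMatrix (P : PowerShape N Nt) {lam : P.Limits} {mu : Fin N → Fin K → ℝ}
    {tau : Fin N → Fin Nt → ℝ} {i : Fin N} (hlam : ∀ k, 0 ≤ lam i k) (hmu : ∀ m l, 0 ≤ mu m l)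
    (htau : ∀ n, 0 < tau i n) : (S.structureMatrix P lam mu tau i).PosDef := by
  unfold structureMatrix
  rw [sum_smul_antennaMatrix]
  refine Matrix.PosDef.posSemidef_add (Matrix.PosSemidef.add ?_ ?_) (posDef_realDiagonal htau)
  · exact Matrix.posSemidef_sum _ fun k _ => posSemidef_real_smul (P.Q_posSemidef i k) (hlam k)
  · exact Matrix.posSemidef_sum _ fun m _ => Matrix.posSemidef_sum _ fun l _ =>
      posSemidef_real_smul (posSemidef_outer (S.h i m l)) (hmu m l)

/-- The stationarity condition: nonnegative multipliers with `M_i w_{i,j}` parallel to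
`h_{i,i,j}`. -/
lemma Unimprovable.exists_multipliers (hη : ConvexOn ℝ (Ici 0) S.eta) (h0 : S.eta 0 = 0)
    (hh : ∀ m i j n, S.h m i j n ≠ 0)
    {P : PowerShape N Nt} {lim : P.Limits} (hlim : ∀ i k, 0 < lim i k) {W : Beamforming N K Nt}
    (hle : ∀ i k, S.consumedPower P W i k ≤ lim i k) (hW : S.Unimprovable P lim W) :
    ∃ (lam : P.Limits) (mu : Fin N → Fin K → ℝ) (tau : Fin N → Fin Nt → ℝ),
      (∀ i k, 0 ≤ lam i k) ∧ (∀ m l, 0 ≤ mu m l) ∧ (∀ i n, 0 ≤ tau i n) ∧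
      (∀ i, (S.structureMatrix P lam mu tau i).PosDef) ∧
      ∀ i j, ∃ ρ : ℂ, S.structureMatrix P lam mu tau i *ᵥ (W i j).ofLp
        = ρ • (S.h i i j).ofLp := by
  classical
  obtain ⟨y, hy0, hyA, ⟨c₀, hc₀⟩, hy⟩ := exists_nonneg_combination_eq_zero
    (Finset.univ.filter (S.IsActive P W)) (fun c => blockFormLeft (S.blocks P W c) W)
    (fun ⟨D, hD⟩ => hW.not_exists_descent hη h0 hlim hle
      ⟨D, fun c hc => hD c (Finset.mem_filter.2 ⟨Finset.mem_univ c, hc⟩)⟩)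
  replace hyA : ∀ c, ¬ S.IsActive P W c → y c = 0 := fun c hc => hyA c (by simpa using hc)
  replace hy : ∀ D, ∑ c, y c * blockForm (S.blocks P W c) D W = 0 := hy
  -- all active forms but those of the SINRs are positive at `W`
  have hsinr : ∃ m l, 0 < y (.inr (.inr (m, l))) := by
    by_contra hno
    push Not at hno
    have hterm : ∀ c, 0 ≤ y c * blockForm (S.blocks P W c) W W ∧
        (0 < y c → 0 < y c * blockForm (S.blocks P W c) W W) := by
      intro c
      have hpos : 0 < y c → 0 < blockForm (S.blocks P W c) W W := by
        intro hyc
        have hact : S.IsActive P W c := by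
          by_contra hc; exact hyc.ne' (hyA c hc)
        match c, hyc, hact with
        | .inl (.inl p), _, hact =>
          simp only [blocks, blockForm_powerBlocks_self h0]; exact hact
        | .inl (.inr a), _, hact =>
          simp only [blocks, blockForm_antennaBlocks]; exact pow_pos hact 2
        | .inr (.inl u), _, hact =>
          simp only [blocks, blockForm_receivedBlocks]
          refine lt_of_lt_of_le ?_ (S.signal_le_receivedPower W u.1 u.2)
          have := (S.sinr_pos_iff W u.1 u.2).1 hact
          positivity
        | .inr (.inr u), hyc, _ => exact absurd hyc (hno u.1 u.2).not_gt
      rcases (hy0 c).eq_or_lt with hz | hp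
      · simp [← hz]
      · exact ⟨(mul_pos hp (hpos hp)).le, fun _ => mul_pos hp (hpos hp)⟩
    exact (Finset.sum_pos' (fun c _ => (hterm c).1)
      ⟨c₀, Finset.mem_univ _, (hterm c₀).2 hc₀⟩).ne' (hy W)
  have hκ := S.distortionSlope_pos h0 W
  have htau : ∀ i n, 0 < S.antennaMultiplier P W y i n := by
    intro i n
    obtain ⟨m, l, hml⟩ := hsinr
    unfold antennaMultiplier
    refine add_pos_of_nonneg_of_pos (add_nonneg (Finset.sum_nonneg fun k _ =>
      mul_nonneg (hy0 _) (mul_nonneg P.delta_mem.1 (mul_nonneg (P.Q_diag_re_nonneg i k n)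
        (by positivity)))) (hy0 _)) ?_
    refine Finset.sum_pos' (fun m _ => Finset.sum_nonneg fun l _ => mul_nonneg (hy0 _)
      (by positivity)) ⟨m, Finset.mem_univ m, Finset.sum_pos' (fun l _ => mul_nonneg (hy0 _)
        (by positivity)) ⟨l, Finset.mem_univ l, mul_pos hml ?_⟩⟩
    have h1 := norm_pos_iff.2 (hh i m l n)
    have h2 := hκ i n
    positivity
  refine ⟨_, _, _, fun i k => hy0 (.inl (.inl ⟨i, k⟩)),
    fun m l => add_nonneg (hy0 (.inr (.inl (m, l)))) (hy0 (.inr (.inr (m, l)))),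
    fun i n => (htau i n).le, fun i => posDef_structureMatrix P (fun k => hy0 _)
    (fun m l => add_nonneg (hy0 _) (hy0 _)) (htau i), fun i j => ?_⟩
  have hstat : (∑ c, (y c : ℂ) • S.blocks P W c i j) *ᵥ (W i j).ofLp = 0 := by
    refine mulVec_eq_zero_of_reForm fun z => ?_
    have h1 := hy (Pi.single i (Pi.single j z))
    have h2 : ∀ B : Fin N → Fin K → Matrix (Fin Nt) (Fin Nt) ℂ,
        blockForm B (Pi.single i (Pi.single j z)) W = reForm (B i j) z (W i j) := by
      intro B
      unfold blockForm
      rw [Finset.sum_eq_single i, Finset.sum_eq_single j]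
      · simp
      · intro b _ hb; simp [hb, reForm]
      · simp
      · intro b _ hb; simp [hb, reForm]
      · simp
    simp only [h2] at h1
    simpa only [reForm_matrix_sum, reForm_matrix_smul] using h1
  rw [sum_smul_blocks, Matrix.sub_mulVec, sub_eq_zero, Matrix.smul_mulVec, outer_mulVec,
    smul_smul] at hstat
  exact ⟨_, hstat⟩

/-! ### From multipliers to normalized directions -/

lemma structureMatrix_smul (P : PowerShape N Nt) (lam : P.Limits) (mu : Fin N → Fin K → ℝ)
    (tau : Fin N → Fin Nt → ℝ) (r : ℝ) (i : Fin N) :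
    S.structureMatrix P (fun i k => r * lam i k) (fun m l => r * mu m l)
      (fun i n => r * tau i n) i = (r : ℂ) • S.structureMatrix P lam mu tau i := by
  simp only [structureMatrix, smul_add, Finset.smul_sum, smul_smul, Complex.ofReal_mul]

/-- Nonnegative parameters can be rescaled to `[0, 1]`. -/
lemma hasStructure_of_mulVec {P : PowerShape N Nt} {W : Beamforming N K Nt} {lam : P.Limits}
    {mu : Fin N → Fin K → ℝ} {tau : Fin N → Fin Nt → ℝ} (hlam : ∀ i k, 0 ≤ lam i k)
    (hmu : ∀ m l, 0 ≤ mu m l) (htau : ∀ i n, 0 ≤ tau i n)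
    (hM : ∀ i, (S.structureMatrix P lam mu tau i).PosDef)
    (hW : ∀ i j, ∃ ρ : ℂ, S.structureMatrix P lam mu tau i *ᵥ (W i j).ofLp
      = ρ • (S.h i i j).ofLp) :
    ∃ c : Fin N → Fin K → ℂ, (∀ i j, ‖c i j‖ = 1) ∧ S.HasStructure P W c := by
  set r : ℝ := (1 + (∑ i, ∑ k, lam i k + ∑ m, ∑ l, mu m l + ∑ i, ∑ n, tau i n))⁻¹ with hr
  have hl0 : 0 ≤ ∑ i, ∑ k, lam i k :=
    Finset.sum_nonneg fun i _ => Finset.sum_nonneg fun k _ => hlam i k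
  have hm0 : 0 ≤ ∑ m, ∑ l, mu m l :=
    Finset.sum_nonneg fun i _ => Finset.sum_nonneg fun k _ => hmu i k
  have ht0 : 0 ≤ ∑ i, ∑ n, tau i n :=
    Finset.sum_nonneg fun i _ => Finset.sum_nonneg fun k _ => htau i k
  have hr0 : 0 < r := by rw [hr]; positivity
  have hmem : ∀ x : ℝ, 0 ≤ x → x ≤ ∑ i, ∑ k, lam i k + ∑ m, ∑ l, mu m l + ∑ i, ∑ n, tau i n →
      r * x ∈ Icc (0 : ℝ) 1 := by
    intro x hx hx'
    refine ⟨by positivity, ?_⟩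
    rw [hr, inv_mul_le_one₀ (by positivity)]
    linarith
  have hρ : ∀ i j, ∃ ρ : ℂ, ((r : ℂ) • S.structureMatrix P lam mu tau i) *ᵥ (W i j).ofLp
      = ρ • (S.h i i j).ofLp := by
    intro i j
    obtain ⟨ρ, h⟩ := hW i j
    exact ⟨r * ρ, by rw [Matrix.smul_mulVec, h, smul_smul]⟩
  choose ρ hρ using hρ
  have hM' : ∀ i, ((r : ℂ) • S.structureMatrix P lam mu tau i).PosDef := fun i =>
    (hM i).smul (by exact_mod_cast hr0)
  refine ⟨fun i j => if W i j = 0 then 1 else ρ i j / ‖ρ i j‖, fun i j => ?_,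
    fun i k => r * lam i k, fun m l => r * mu m l, fun i n => r * tau i n, fun i k => ?_,
    fun m l => ?_, fun i n => ?_, fun i => ?_, fun i j => ?_⟩
  · have hne : W i j ≠ 0 → ρ i j ≠ 0 := by
      intro hw hz
      have h1 := reForm_self_pos (hM' i) hw
      rw [reForm, hρ, hz] at h1
      simp at h1
    dsimp only
    split_ifs with hw
    · simp
    · simp [hne hw]
  · refine hmem _ (hlam i k) ?_
    have h1 : lam i k ≤ ∑ k, lam i k :=
      Finset.single_le_sum (f := fun k => lam i k) (fun k _ => hlam i k) (Finset.mem_univ k)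
    have h2 : ∑ k, lam i k ≤ ∑ i, ∑ k, lam i k :=
      Finset.single_le_sum (f := fun i => ∑ k, lam i k)
        (fun i _ => Finset.sum_nonneg fun k _ => hlam i k) (Finset.mem_univ i)
    linarith
  · refine hmem _ (hmu m l) ?_
    have h1 : mu m l ≤ ∑ l, mu m l :=
      Finset.single_le_sum (f := fun k => mu m k) (fun k _ => hmu m k) (Finset.mem_univ l)
    have h2 : ∑ l, mu m l ≤ ∑ m, ∑ l, mu m l :=
      Finset.single_le_sum (f := fun i => ∑ k, mu i k)
        (fun i _ => Finset.sum_nonneg fun k _ => hmu i k) (Finset.mem_univ m)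
    linarith
  · refine hmem _ (htau i n) ?_
    have h1 : tau i n ≤ ∑ n, tau i n :=
      Finset.single_le_sum (f := fun k => tau i k) (fun k _ => htau i k) (Finset.mem_univ n)
    have h2 : ∑ n, tau i n ≤ ∑ i, ∑ n, tau i n :=
      Finset.single_le_sum (f := fun i => ∑ k, tau i k)
        (fun i _ => Finset.sum_nonneg fun k _ => htau i k) (Finset.mem_univ i)
    linarith
  · rw [structureMatrix_smul]; exact hM' i
  · by_cases hw : W i j = 0
    · simp [hw, userPower]
    have hdet : IsUnit ((r : ℂ) • S.structureMatrix P lam mu tau i).det :=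
      (Matrix.isUnit_iff_isUnit_det _).1 (hM' i).isUnit
    have hWv : W i j = ρ i j • S.structureVector P (fun i k => r * lam i k)
        (fun m l => r * mu m l) (fun i n => r * tau i n) i j := by
      unfold structureVector
      rw [structureMatrix_smul]
      have h1 := congrArg (fun v => ((r : ℂ) • S.structureMatrix P lam mu tau i)⁻¹ *ᵥ v) (hρ i j)
      simp only [Matrix.mulVec_mulVec, Matrix.nonsing_inv_mul _ hdet, Matrix.one_mulVec,
        Matrix.mulVec_smul] at h1
      ext n
      rw [h1]; rfl
    simp only [if_neg hw]
    rw [structureDirection, userPower, Real.sqrt_sq (norm_nonneg _), smul_smul]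
    have hn : ‖W i j‖ = ‖ρ i j‖ * ‖S.structureVector P (fun i k => r * lam i k)
        (fun m l => r * mu m l) (fun i n => r * tau i n) i j‖ := by
      conv_lhs => rw [hWv, norm_smul]
    have hv0 : ‖S.structureVector P (fun i k => r * lam i k)
        (fun m l => r * mu m l) (fun i n => r * tau i n) i j‖ ≠ 0 := fun h => by
      rw [h, mul_zero, norm_eq_zero] at hn; exact hw hn
    have hρ0 : ‖ρ i j‖ ≠ 0 := fun h => by
      rw [h, zero_mul, norm_eq_zero] at hn; exact hw hn
    rw [hn]
    conv_lhs => rw [hWv]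
    congr 1
    have hv0' := Complex.ofReal_ne_zero.2 hv0
    have hρ0' := Complex.ofReal_ne_zero.2 hρ0
    push_cast
    field_simp

lemma hasStructure_zero (P : PowerShape N Nt) (c : Fin N → Fin K → ℂ) :
    S.HasStructure P (0 : Beamforming N K Nt) c := by
  refine ⟨fun _ _ => 1, fun _ _ => 0, fun _ _ => 0, by simp, by simp, by simp, fun i => ?_,
    fun i j => by simp [userPower]⟩
  simpa [structureMatrix] using P.Q_sum_posDef i

lemma Unimprovable.hasStructure (hη : ConvexOn ℝ (Ici 0) S.eta) (h0 : S.eta 0 = 0)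
    (hh : ∀ m i j n, S.h m i j n ≠ 0)
    {P : PowerShape N Nt} {lim : P.Limits} (hlim : ∀ i k, 0 < lim i k) {W : Beamforming N K Nt}
    (hle : ∀ i k, S.consumedPower P W i k ≤ lim i k) (hW : S.Unimprovable P lim W) :
    ∃ c : Fin N → Fin K → ℂ, (∀ i j, ‖c i j‖ = 1) ∧ S.HasStructure P W c := by
  obtain ⟨lam, mu, tau, h1, h2, h3, h4, h5⟩ := hW.exists_multipliers hη h0 hh hlim hle
  exact hasStructure_of_mulVec h1 h2 h3 h4 h5

/-! ### Phase rotations -/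

section phases

variable {W : Beamforming N K Nt} {c : Fin N → Fin K → ℂ}

/-- Multiplication of all beamforming vectors by complex factors. -/
def rotate (c : Fin N → Fin K → ℂ) (W : Beamforming N K Nt) : Beamforming N K Nt :=
  fun i j => c i j • W i j

lemma antennaAmp_rotate (hc : ∀ i j, ‖c i j‖ = 1) (i : Fin N) (n : Fin Nt) :
    antennaAmp (rotate c W i) n = antennaAmp (W i) n := by
  simp [antennaAmp, rotate, hc]

lemma norm_inner_rotate (hc : ∀ i j, ‖c i j‖ = 1) (h : EuclideanSpace ℂ (Fin Nt)) (i : Fin N)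
    (j : Fin K) : ‖(inner ℂ h (rotate c W i j) : ℂ)‖ = ‖(inner ℂ h (W i j) : ℂ)‖ := by
  rw [rotate, inner_smul_right, norm_mul, hc, one_mul]

lemma performance_rotate (hc : ∀ i j, ‖c i j‖ = 1) (i : Fin N) (j : Fin K) :
    S.performance (rotate c W) i j = S.performance W i j := by
  simp only [performance, sinr, interferencePlusNoise_eq, receivedPower, rowPower,
    norm_inner_rotate hc, distortionPower, antennaAmp_rotate hc]

lemma consumedPower_rotate (hc : ∀ i j, ‖c i j‖ = 1) (P : PowerShape N Nt) (i : Fin N)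
    (k : Fin (P.L i)) : S.consumedPower P (rotate c W) i k = S.consumedPower P W i k := by
  have hQ : ∀ j, reForm (P.Q i k) (rotate c W i j) (rotate c W i j)
      = reForm (P.Q i k) (W i j) (W i j) := by
    intro j
    have h1 : star (rotate c W i j).ofLp = star (c i j) • star (W i j).ofLp := by
      ext n; simp [rotate]
    have h2 : (rotate c W i j).ofLp = c i j • (W i j).ofLp := rfl
    rw [reForm, h1, h2, Matrix.mulVec_smul, smul_dotProduct, dotProduct_smul, smul_smul,
      Complex.star_def, mul_comm, Complex.mul_conj, Complex.normSq_eq_norm_sq, hc]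
    simp [reForm]
  simp only [consumedPower_eq, hQ, antennaAmp_rotate hc]

lemma HasStructure.rotate_conj {P : PowerShape N Nt} (hc : ∀ i j, ‖c i j‖ = 1)
    (h : S.HasStructure P W c) :
    S.HasStructure P (rotate (fun i j => star (c i j)) W) (fun _ _ => 1) := by
  obtain ⟨lam, mu, tau, h1, h2, h3, h4, h5⟩ := h
  refine ⟨lam, mu, tau, h1, h2, h3, h4, fun i j => ?_⟩
  have hp : userPower (rotate (fun i j => star (c i j)) W) i j = userPower W i j := by
    simp [userPower, rotate, norm_smul, hc]
  have hcc : star (c i j) * c i j = 1 := by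
    rw [Complex.star_def, mul_comm, Complex.mul_conj, Complex.normSq_eq_norm_sq, hc]; simp
  rw [hp, rotate]
  conv_lhs => rw [h5 i j, smul_smul, ← mul_assoc, hcc]

end phases

end DownlinkSystem

/-! ### Growth of the impairment characteristics -/

lemma GrowsFasterThanLinear.exists_lt {f : ℝ → ℝ} (hf : GrowsFasterThanLinear f)
    (hnn : ∀ x, 0 ≤ x → 0 ≤ f x) (C : ℝ) : ∃ X, 1 ≤ X ∧ ∀ x, X ≤ x → C * x < f x := by
  have hC : 0 < (|C| + 1)⁻¹ := by positivity
  obtain ⟨X, hX⟩ := eventually_atTop.1 (hf.1.and (hf.2.eventually_lt_const hC))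
  refine ⟨max X 1, le_max_right _ _, fun x hx => ?_⟩
  obtain ⟨h1, h2⟩ := hX x ((le_max_left _ _).trans hx)
  have hx1 : 1 ≤ x := (le_max_right _ _).trans hx
  have hpos : 0 < f x := (hnn x (by linarith)).lt_of_ne' h1
  rw [div_lt_iff₀ hpos, ← div_eq_inv_mul, lt_div_iff₀ (by positivity)] at h2
  nlinarith [le_abs_self C]

namespace DownlinkSystem

variable {N K Nt : ℕ} {S : DownlinkSystem N K Nt}

lemma eta_unbounded (hη : ConvexOn ℝ (Ici 0) S.eta) (h0 : S.eta 0 = 0) (C : ℝ) :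
    ∃ X, ∀ x, X ≤ x → C < S.eta x := by
  have h1 := S.eta_pos h0 one_pos
  refine ⟨max 1 ((|C| + 1) / S.eta 1), fun x hx => ?_⟩
  have hx1 : 1 ≤ x := (le_max_left _ _).trans hx
  have hx2 := (div_le_iff₀ h1).1 ((le_max_right _ _).trans hx)
  have h2 := hη.le_div_mul h0 (b := x) (t := 1) (by linarith) zero_le_one hx1
  rw [mul_one, le_div_iff₀ (by linarith)] at h2
  nlinarith [le_abs_self C]

variable (S) in
lemma exists_pos_le_channel (hh : ∀ m i j n, S.h m i j n ≠ 0) :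
    ∃ c > 0, ∀ m i j n, c ≤ ‖S.h m i j n‖ ^ 2 := by
  rcases isEmpty_or_nonempty (Fin N × Fin N × Fin K × Fin Nt) with he | hne
  · exact ⟨1, one_pos, fun m i j n => (he.false (m, i, j, n)).elim⟩
  · obtain ⟨u, hu⟩ := Finite.exists_min fun u : Fin N × Fin N × Fin K × Fin Nt =>
      ‖S.h u.1 u.2.1 u.2.2.1 u.2.2.2‖ ^ 2
    exact ⟨_, pow_pos (norm_pos_iff.2 (hh u.1 u.2.1 u.2.2.1 u.2.2.2)) 2,
      fun m i j n => hu (m, i, j, n)⟩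

variable (S) in
lemma exists_interferencePlusNoise_le (R : ℝ) :
    ∃ C > 0, ∀ W : Beamforming N K Nt, (∀ i j, ‖W i j‖ ≤ R) →
      ∀ i j, S.interferencePlusNoise W i j ≤ C := by
  have hcont : Continuous fun (W : Beamforming N K Nt) (i : Fin N) (j : Fin K) =>
      S.interferencePlusNoise W i j :=
    continuous_pi fun i => continuous_pi fun j => S.continuous_interferencePlusNoise i j
  obtain ⟨C, hC⟩ := (isCompact_closedBall (0 : Beamforming N K Nt)
    |R|).exists_bound_of_continuousOn hcont.continuousOn
  refine ⟨|C| + 1, by positivity, fun W hW i j => ?_⟩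
  have h1 : W ∈ Metric.closedBall (0 : Beamforming N K Nt) |R| := by
    rw [mem_closedBall_zero_iff, pi_norm_le_iff_of_nonneg (abs_nonneg R)]
    intro i
    rw [pi_norm_le_iff_of_nonneg (abs_nonneg R)]
    exact fun j => (hW i j).trans (le_abs_self R)
  have h2 := (norm_le_pi_norm _ j).trans ((norm_le_pi_norm _ i).trans (hC W h1))
  have h3 := Real.le_norm_self (S.interferencePlusNoise W i j)
  linarith [le_abs_self C]

lemma distortion_le_interferencePlusNoise {c : ℝ} (hc : ∀ m i j n, c ≤ ‖S.h m i j n‖ ^ 2)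
    (W : Beamforming N K Nt) (i : Fin N) (j : Fin K) (m : Fin N) (n : Fin Nt) :
    c * S.eta (antennaAmp (W m) n) ^ 2
      ≤ S.interferencePlusNoise W i j
        - (S.receivedPower W i j - ‖(inner ℂ (S.h i i j) (W i j) : ℂ)‖ ^ 2) := by
  have h1 : c * S.eta (antennaAmp (W m) n) ^ 2 ≤ S.distortionPower (S.h m i j) (W m) :=
    (mul_le_mul_of_nonneg_right (hc m i j n) (by positivity)).trans
      (Finset.single_le_sum (f := fun n => ‖S.h m i j n‖ ^ 2 * S.eta (antennaAmp (W m) n) ^ 2)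
        (fun _ _ => by positivity) (Finset.mem_univ n))
  have h2 : S.distortionPower (S.h m i j) (W m) ≤ ∑ m, S.distortionPower (S.h m i j) (W m) :=
    Finset.single_le_sum (f := fun m => S.distortionPower (S.h m i j) (W m))
      (fun _ _ => S.distortionPower_nonneg _ _) (Finset.mem_univ m)
  rw [interferencePlusNoise_eq]
  have h3 := S.noise_pos
  have h4 := sq_nonneg (S.nu (Real.sqrt (S.receivedPower W i j)))
  linarith

lemma nu_sq_le_interferencePlusNoise (W : Beamforming N K Nt) (i : Fin N) (j : Fin K) :
    S.nu (Real.sqrt (S.receivedPower W i j)) ^ 2 ≤ S.interferencePlusNoise W i j := by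
  rw [interferencePlusNoise_eq]
  have h1 := S.signal_le_receivedPower W i j
  have h2 := S.sum_distortionPower_nonneg W i j
  have h3 := S.noise_pos
  linarith

lemma userPower_le_of_antennaAmp_le {W : Beamforming N K Nt} {A : ℝ}
    (hA : ∀ i n, antennaAmp (W i) n ≤ A) (i : Fin N) (j : Fin K) :
    userPower W i j ≤ Nt * A ^ 2 := by
  refine (norm_sq_le_sum_antennaAmp_sq (W i) j).trans ?_
  calc ∑ n, antennaAmp (W i) n ^ 2 ≤ ∑ _n : Fin Nt, A ^ 2 :=
        Finset.sum_le_sum fun n _ => pow_le_pow_left₀ (antennaAmp_nonneg _ _) (hA i n) 2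
    _ = Nt * A ^ 2 := by simp

/-! ### Shrinking beamforming vectors -/

section shrink

variable {W : Beamforming N K Nt} {θ : Fin N → Fin K → ℝ}

/-- Multiplication of all beamforming vectors by real factors. -/
def shrink (θ : Fin N → Fin K → ℝ) (W : Beamforming N K Nt) : Beamforming N K Nt :=
  fun i j => θ i j • W i j

lemma norm_shrink_apply_le (hθ : ∀ i j, θ i j ∈ Icc (0 : ℝ) 1) (i : Fin N) (j : Fin K)
    (n : Fin Nt) : ‖shrink θ W i j n‖ ≤ ‖W i j n‖ := by
  rw [shrink, PiLp.smul_apply, norm_smul, Real.norm_of_nonneg (hθ i j).1]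
  exact mul_le_of_le_one_left (norm_nonneg _) (hθ i j).2

lemma norm_inner_shrink (h : EuclideanSpace ℂ (Fin Nt)) (i : Fin N) (j : Fin K) :
    ‖(inner ℂ h (shrink θ W i j) : ℂ)‖ = |θ i j| * ‖(inner ℂ h (W i j) : ℂ)‖ := by
  rw [shrink, inner_smul_right_eq_smul, norm_smul, Real.norm_eq_abs]

lemma antennaAmp_shrink_le (hθ : ∀ i j, θ i j ∈ Icc (0 : ℝ) 1) (i : Fin N) (n : Fin Nt) :
    antennaAmp (shrink θ W i) n ≤ antennaAmp (W i) n :=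
  antennaAmp_le fun k => norm_shrink_apply_le hθ i k n

lemma consumedPower_shrink_le (hθ : ∀ i j, θ i j ∈ Icc (0 : ℝ) 1) (P : PowerShape N Nt)
    (i : Fin N) (k : Fin (P.L i)) :
    S.consumedPower P (shrink θ W) i k ≤ S.consumedPower P W i k := by
  refine consumedPower_le_of_amp_le (Finset.sum_le_sum fun j _ => ?_) (antennaAmp_shrink_le hθ i)
  have h1 := reForm_self_nonneg (W i j) (P.Q_posSemidef i k)
  rw [shrink, reForm_smul_left, reForm_smul_right, ← mul_assoc]
  exact mul_le_of_le_one_left h1 (mul_le_one₀ (hθ i j).2 (hθ i j).1 (hθ i j).2)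

lemma receivedPower_shrink_le (hθ : ∀ i j, θ i j ∈ Icc (0 : ℝ) 1) (i : Fin N) (j : Fin K) :
    S.receivedPower (shrink θ W) i j ≤ S.receivedPower W i j := by
  refine Finset.sum_le_sum fun m _ => Finset.sum_le_sum fun k _ =>
    pow_le_pow_left₀ (norm_nonneg _) ?_ 2
  rw [norm_inner_shrink, abs_of_nonneg (hθ m k).1]
  exact mul_le_of_le_one_left (norm_nonneg _) (hθ m k).2

/-- A user whose own vector is unchanged benefits strictly if a nonzero vector of anybody else is
shrunk: all channel entries are nonzero, so the transmitter distortion decreases at every user. -/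
lemma sinr_lt_sinr_shrink (hh : ∀ m i j n, S.h m i j n ≠ 0)
    (hθ : ∀ i j, θ i j ∈ Icc (0 : ℝ) 1) {i : Fin N} {j : Fin K} (hij : θ i j = 1)
    {m : Fin N} {l : Fin K} (hml : θ m l < 1) (hw : W m l ≠ 0) (hs : 0 < S.sinr W i j) :
    S.sinr W i j < S.sinr (shrink θ W) i j := by
  have hamp := antennaAmp_shrink_le (W := W) hθ
  have hη : ∀ a n, S.eta (antennaAmp (shrink θ W a) n) ≤ S.eta (antennaAmp (W a) n) := fun a n =>
    S.eta_mono (antennaAmp_nonneg _ _) (hamp a n)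
  obtain ⟨n, hn⟩ : ∃ n, W m l n ≠ 0 := by
    by_contra hc
    push Not at hc
    exact hw (by ext n; simpa using hc n)
  have hamp' : antennaAmp (shrink θ W m) n < antennaAmp (W m) n := by
    refine Real.sqrt_lt_sqrt (Finset.sum_nonneg fun _ _ => by positivity)
      (Finset.sum_lt_sum (fun k _ => pow_le_pow_left₀ (norm_nonneg _)
        (norm_shrink_apply_le hθ m k n) 2) ⟨l, Finset.mem_univ l, ?_⟩)
    refine pow_lt_pow_left₀ ?_ (norm_nonneg _) two_ne_zero
    rw [shrink, PiLp.smul_apply, norm_smul, Real.norm_of_nonneg (hθ m l).1]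
    exact mul_lt_of_lt_one_left (norm_pos_iff.2 hn) hml
  have hd : ∑ a, S.distortionPower (S.h a i j) (shrink θ W a)
      < ∑ a, S.distortionPower (S.h a i j) (W a) := by
    have hle : ∀ a b, ‖S.h a i j b‖ ^ 2 * S.eta (antennaAmp (shrink θ W a) b) ^ 2
        ≤ ‖S.h a i j b‖ ^ 2 * S.eta (antennaAmp (W a) b) ^ 2 := fun a b =>
      mul_le_mul_of_nonneg_left (pow_le_pow_left₀ (S.eta_nonneg _ (antennaAmp_nonneg _ _))
        (hη a b) 2) (by positivity)
    refine Finset.sum_lt_sum (fun a _ => Finset.sum_le_sum fun b _ => hle a b)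
      ⟨m, Finset.mem_univ m, Finset.sum_lt_sum (fun b _ => hle m b) ⟨n, Finset.mem_univ n, ?_⟩⟩
    refine mul_lt_mul_of_pos_left ?_ (pow_pos (norm_pos_iff.2 (hh m i j n)) 2)
    exact pow_lt_pow_left₀ (S.eta_strictMono (antennaAmp_nonneg _ _) (antennaAmp_nonneg _ _) hamp')
      (S.eta_nonneg _ (antennaAmp_nonneg _ _)) two_ne_zero
  have hr := receivedPower_shrink_le (S := S) (W := W) hθ i j
  have hν : S.nu (Real.sqrt (S.receivedPower (shrink θ W) i j)) ^ 2
      ≤ S.nu (Real.sqrt (S.receivedPower W i j)) ^ 2 :=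
    pow_le_pow_left₀ (S.nu_nonneg _ (Real.sqrt_nonneg _))
      (S.nu_mono (Real.sqrt_nonneg _) (Real.sqrt_nonneg _) (Real.sqrt_le_sqrt hr)) 2
  have hX : ‖(inner ℂ (S.h i i j) (shrink θ W i j) : ℂ)‖ = ‖(inner ℂ (S.h i i j) (W i j) : ℂ)‖ := by
    rw [norm_inner_shrink, hij, abs_one, one_mul]
  have hI : S.interferencePlusNoise (shrink θ W) i j < S.interferencePlusNoise W i j := by
    rw [interferencePlusNoise_eq, interferencePlusNoise_eq, hX]
    linarith
  unfold sinr
  rw [hX]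
  refine div_lt_div_of_pos_left ?_ (S.interferencePlusNoise_pos _ i j) hI
  have := (S.sinr_pos_iff W i j).1 hs
  positivity

end shrink

/-! ### Bounded power under a superlinear transmitter distortion -/

/-- If `η` grows faster than linearly, amplitudes above a threshold are wasteful: scaling the whole
beamforming down to maximal amplitude one improves every served user. -/
lemma exists_antennaAmp_le_of_eta (hh : ∀ m i j n, S.h m i j n ≠ 0)
    (hη : GrowsFasterThanLinear S.eta) :
    ∃ A, ∀ (P : PowerShape N Nt) (lim : P.Limits) (W : Beamforming N K Nt),
      (∀ i k, S.consumedPower P W i k ≤ lim i k) → S.Unimprovable P lim W →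
        ∀ i n, antennaAmp (W i) n ≤ A := by
  obtain ⟨c, hc0, hc⟩ := S.exists_pos_le_channel hh
  obtain ⟨C, hC0, hC⟩ := S.exists_interferencePlusNoise_le (Real.sqrt Nt)
  obtain ⟨X, hX1, hX⟩ := hη.exists_lt S.eta_nonneg (Real.sqrt (C / c))
  refine ⟨X, fun P lim W hle hW i₁ n₁ => ?_⟩
  by_contra hbig
  push Not at hbig
  obtain ⟨⟨i₀, n₀⟩, hmax⟩ : ∃ u : Fin N × Fin Nt, ∀ v : Fin N × Fin Nt,
      antennaAmp (W v.1) v.2 ≤ antennaAmp (W u.1) u.2 :=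
    haveI : Nonempty (Fin N × Fin Nt) := ⟨(i₁, n₁)⟩
    Finite.exists_max fun v : Fin N × Fin Nt => antennaAmp (W v.1) v.2
  set t := antennaAmp (W i₀) n₀ with ht
  have htX : X ≤ t := hbig.le.trans (hmax (i₁, n₁))
  have ht1 : 1 ≤ t := hX1.trans htX
  have ht0 : 0 < t := by linarith
  have hθ : ∀ (i : Fin N) (j : Fin K), t⁻¹ ∈ Icc (0 : ℝ) 1 := fun _ _ =>
    ⟨by positivity, inv_le_one_of_one_le₀ ht1⟩
  refine hW (shrink (fun _ _ => t⁻¹) W) (fun i j hs => ?_) fun i k =>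
    (consumedPower_shrink_le hθ P i k).trans (hle i k)
  have hamp : ∀ i n, antennaAmp (shrink (fun _ _ => t⁻¹) W i) n ≤ 1 := by
    intro i n
    have h1 : antennaAmp (shrink (fun _ _ => t⁻¹) W i) n = t⁻¹ * antennaAmp (W i) n :=
      antennaAmp_smul (W i) n t⁻¹ (by positivity)
    rw [h1, inv_mul_le_one₀ ht0]
    exact hmax (i, n)
  have hI' : S.interferencePlusNoise (shrink (fun _ _ => t⁻¹) W) i j ≤ C := by
    refine hC _ (fun i j => Real.le_sqrt_of_sq_le ?_) i j
    simpa [userPower] using userPower_le_of_antennaAmp_le hamp i j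
  have hI : C * t ^ 2 < S.interferencePlusNoise W i j := by
    have h1 := pow_lt_pow_left₀ (hX t htX) (by positivity) two_ne_zero
    rw [mul_pow, Real.sq_sqrt (by positivity), div_mul_eq_mul_div, div_lt_iff₀' hc0] at h1
    have h2 := distortion_le_interferencePlusNoise hc W i j i₀ n₀
    have h3 := S.signal_le_receivedPower W i j
    linarith
  have hX0 : 0 < ‖(inner ℂ (S.h i i j) (W i j) : ℂ)‖ ^ 2 := by
    have := (S.sinr_pos_iff W i j).1 hs
    positivity
  unfold sinr
  rw [norm_inner_shrink, mul_pow, sq_abs, inv_pow, div_lt_div_iff₀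
    (S.interferencePlusNoise_pos W i j) (S.interferencePlusNoise_pos _ i j), mul_comm (_)⁻¹,
    mul_assoc]
  refine mul_lt_mul_of_pos_left (hI'.trans_lt ?_) hX0
  rwa [lt_inv_mul_iff₀ (by positivity), mul_comm]

/-! ### Bounded power under a superlinear receiver distortion -/

/-- If `η` is convex and `ν` grows faster than linearly, a user with a positive rate demand forces
all amplitudes to be bounded: its received power is bounded because of its own distortion, and
therefore so is the transmitter distortion of all base stations. -/
lemma exists_antennaAmp_le_of_nu (h0 : S.eta 0 = 0) (hh : ∀ m i j n, S.h m i j n ≠ 0)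
    (hη : ConvexOn ℝ (Ici 0) S.eta) (hν : GrowsFasterThanLinear S.nu) {i : Fin N} {j : Fin K}
    {γ : ℝ} (hγ : 0 < γ) :
    ∃ A, ∀ W : Beamforming N K Nt, γ ≤ S.performance W i j → ∀ m n, antennaAmp (W m) n ≤ A := by
  obtain ⟨s, hs0, hs⟩ : ∃ s > 0, S.g i j s < γ := by
    have h1 : Tendsto (S.g i j) (𝓝[>] 0) (𝓝 (S.g i j 0)) :=
      (S.g_cont i j 0 self_mem_Ici).mono_left (nhdsWithin_mono _ Ioi_subset_Ici_self)
    rw [S.g_zero] at h1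
    obtain ⟨s, h2, h3⟩ := ((h1.eventually_lt_const hγ).and
      (self_mem_nhdsWithin : Ioi (0 : ℝ) ∈ 𝓝[>] 0)).exists
    exact ⟨s, h3, h2⟩
  obtain ⟨c, hc0, hc⟩ := S.exists_pos_le_channel hh
  obtain ⟨X, hX1, hX⟩ := hν.exists_lt S.nu_nonneg (Real.sqrt (1 / s))
  obtain ⟨A, hA⟩ := S.eta_unbounded hη h0 (Real.sqrt (X ^ 2 / (s * c)))
  refine ⟨A, fun W hW m n => ?_⟩
  have hsinr : s ≤ S.sinr W i j := by
    by_contra hlt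
    push Not at hlt
    exact (hs.trans_le hW).not_ge
      ((S.g_strictMono i j).monotoneOn (S.sinr_nonneg W i j) (mem_Ici.2 hs0.le) hlt.le)
  rw [sinr, le_div_iff₀ (S.interferencePlusNoise_pos W i j)] at hsinr
  have hsig := S.signal_le_receivedPower W i j
  set r := Real.sqrt (S.receivedPower W i j) with hr
  have hr0 : 0 ≤ r := Real.sqrt_nonneg _
  have hr2 : r ^ 2 = S.receivedPower W i j := Real.sq_sqrt (S.receivedPower_nonneg W i j)
  have hrX : r < X := by
    by_contra hge
    push Not at hge
    have h1 := pow_lt_pow_left₀ (hX r hge) (by positivity) two_ne_zero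
    rw [mul_pow, Real.sq_sqrt (by positivity), one_div, inv_mul_lt_iff₀ hs0] at h1
    have h2 := mul_le_mul_of_nonneg_left (nu_sq_le_interferencePlusNoise (S := S) W i j) hs0.le
    linarith
  by_contra hlt
  push Not at hlt
  have h1 := pow_lt_pow_left₀ (hA _ hlt.le) (by positivity) two_ne_zero
  rw [Real.sq_sqrt (by positivity), div_lt_iff₀ (by positivity)] at h1
  have h2 := distortion_le_interferencePlusNoise hc W i j m n
  have h3 : r ^ 2 < X ^ 2 := pow_lt_pow_left₀ hrX hr0 two_ne_zero
  nlinarith [mul_le_mul_of_nonneg_left h2 hs0.le]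

end DownlinkSystem

/-! ### Uniform alignment of structured directions -/

/-- The solutions of `M x = ρ h` are uniformly aligned with `h`, over all positive definite
matrices `M` in the cone spanned by finitely many positive semidefinite matrices. -/
lemma exists_norm_le_mul_norm_inner {n : ℕ} {ι : Type*} [Fintype ι]
    (A : ι → Matrix (Fin n) (Fin n) ℂ) (hA : ∀ k, (A k).PosSemidef)
    (h : EuclideanSpace ℂ (Fin n)) :
    ∃ C > 0, ∀ (y : ι → ℝ) (x : EuclideanSpace ℂ (Fin n)) (ρ : ℂ), (∀ k, 0 ≤ y k) →
      (∑ k, (y k : ℂ) • A k).PosDef → (∑ k, (y k : ℂ) • A k) *ᵥ x.ofLp = ρ • h.ofLp →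
        ‖x‖ ≤ C * ‖(inner ℂ h x : ℂ)‖ := by
  by_contra hcon
  push Not at hcon
  have hseq : ∀ m : ℕ, ∃ (y : ι → ℝ) (u : EuclideanSpace ℂ (Fin n)) (ρ : ℂ), (∀ k, 0 ≤ y k) ∧
      (∑ k, (y k : ℂ) • A k).PosDef ∧ (∑ k, (y k : ℂ) • A k) *ᵥ u.ofLp = ρ • h.ofLp ∧
      ‖u‖ = 1 ∧ ‖(inner ℂ h u : ℂ)‖ ≤ 1 / ((m : ℝ) + 1) := by
    intro m
    obtain ⟨y, x, ρ, hy, hM, hx, hlt⟩ := hcon ((m : ℝ) + 1) (by positivity)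
    have hx0 : 0 < ‖x‖ := lt_of_le_of_lt (by positivity) hlt
    refine ⟨y, (‖x‖⁻¹ : ℝ) • x, ((‖x‖⁻¹ : ℝ) : ℂ) * ρ, hy, hM, ?_, ?_, ?_⟩
    · have : ((‖x‖⁻¹ : ℝ) • x).ofLp = ((‖x‖⁻¹ : ℝ) : ℂ) • x.ofLp := by ext k; simp
      rw [this, Matrix.mulVec_smul, hx, smul_smul]
    · rw [norm_smul, norm_inv, norm_norm, inv_mul_cancel₀ hx0.ne']
    · rw [inner_smul_right_eq_smul, norm_smul, norm_inv, norm_norm, le_div_iff₀ (by positivity),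
        mul_assoc, inv_mul_le_one₀ hx0, mul_comm]
      exact hlt.le
  choose y u ρ hy hM hu hu1 hinner using hseq
  obtain ⟨v, hv, φ, hφ, hlim⟩ := (isCompact_sphere (0 : EuclideanSpace ℂ (Fin n))
    1).tendsto_subseq (x := u) fun m => by simpa using hu1 m
  have hv0 : v ≠ 0 := by rintro rfl; simp at hv
  have hhv : (inner ℂ h v : ℂ) = 0 := by
    have h1 : Tendsto (fun m => ‖(inner ℂ h (u (φ m)) : ℂ)‖) atTop (𝓝 ‖(inner ℂ h v : ℂ)‖) :=
      ((continuous_const.inner continuous_id).norm.tendsto v).comp hlim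
    have h2 : Tendsto (fun m => 1 / (((φ m : ℕ) : ℝ) + 1)) atTop (𝓝 0) :=
      tendsto_one_div_add_atTop_nhds_zero_nat.comp hφ.tendsto_atTop
    exact norm_le_zero_iff.1 (le_of_tendsto_of_tendsto' h1 h2 fun m => hinner (φ m))
  have hkill : ∀ k, reForm (A k) v v = 0 → A k *ᵥ v.ofLp = 0 := by
    intro k hk
    refine ((hA k).dotProduct_mulVec_zero_iff v.ofLp).1 (Complex.ext hk ?_)
    exact (Complex.le_def.1 ((hA k).dotProduct_mulVec_nonneg v.ofLp)).2.symm
  -- the limit direction `v` is orthogonal to `h`, so testing with `v` kills the right-hand side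
  have hev : ∀ᶠ m in atTop, ∀ k, 0 < reForm (A k) v v → 0 < reForm (A k) v (u (φ m)) := by
    simp only [eventually_all]
    intro k hk
    have hcont : Continuous fun z => reForm (A k) v z := by fun_prop
    exact ((hcont.tendsto v).comp hlim).eventually_const_lt hk
  obtain ⟨m, hm⟩ := hev.exists
  have hzero : ∑ k, y (φ m) k * reForm (A k) v (u (φ m)) = 0 := by
    have h1 : reForm (∑ k, (y (φ m) k : ℂ) • A k) v (u (φ m)) = 0 := by
      rw [reForm, hu, dotProduct_smul]
      have h2 : star v.ofLp ⬝ᵥ h.ofLp = 0 := by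
        rw [← inner_eq_dotProduct, ← inner_conj_symm, hhv, map_zero]
      rw [h2]; simp
    simpa only [reForm_matrix_sum, reForm_matrix_smul] using h1
  have hnn : ∀ k, 0 ≤ y (φ m) k * reForm (A k) v (u (φ m)) := by
    intro k
    refine mul_nonneg (hy _ _) ?_
    rcases (reForm_self_nonneg v (hA k)).eq_or_lt with hz | hp
    · rw [reForm_comm _ _ (hA k).isHermitian, reForm, hkill k hz.symm]; simp
    · exact (hm k hp).le
  have hall := (Finset.sum_eq_zero_iff_of_nonneg fun k _ => hnn k).1 hzero
  have hpos := reForm_self_pos (hM (φ m)) hv0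
  rw [reForm_matrix_sum] at hpos
  refine hpos.ne' (Finset.sum_eq_zero fun k hk => ?_)
  rw [reForm_matrix_smul]
  rcases mul_eq_zero.1 (hall k hk) with h1 | h1
  · rw [h1, zero_mul]
  · rcases (reForm_self_nonneg v (hA k)).eq_or_lt with hz | hp
    · rw [← hz, mul_zero]
    · exact absurd h1 (hm k hp).ne'

namespace DownlinkSystem

variable {N K Nt : ℕ} {S : DownlinkSystem N K Nt}

variable (S) in
/-- Along all beamformings with the structure, the power of a user is controlled by its received
signal. -/
lemma exists_norm_le_of_hasStructure (P : PowerShape N Nt) :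
    ∃ C > 0, ∀ (W : Beamforming N K Nt) (c : Fin N → Fin K → ℂ), S.HasStructure P W c →
      ∀ i j, ‖W i j‖ ≤ C * ‖(inner ℂ (S.h i i j) (W i j) : ℂ)‖ := by
  have hex : ∀ i j, ∃ C > 0, ∀ (W : Beamforming N K Nt) (c : Fin N → Fin K → ℂ),
      S.HasStructure P W c → ‖W i j‖ ≤ C * ‖(inner ℂ (S.h i i j) (W i j) : ℂ)‖ := by
    intro i j
    let A : (Fin (P.L i) ⊕ (Fin N × Fin K)) ⊕ Fin Nt → Matrix (Fin Nt) (Fin Nt) ℂ :=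
      Sum.elim (Sum.elim (P.Q i) fun u => outer (S.h i u.1 u.2)) antennaMatrix
    have hA : ∀ k, (A k).PosSemidef := by
      rintro ((k | u) | n)
      · exact P.Q_posSemidef i k
      · exact posSemidef_outer _
      · refine Matrix.PosSemidef.diagonal fun k => ?_
        dsimp only
        split_ifs <;> simp
    obtain ⟨C, hC0, hC⟩ := exists_norm_le_mul_norm_inner A hA (S.h i i j)
    refine ⟨C, hC0, fun W c hW => ?_⟩
    obtain ⟨lam, mu, tau, h1, h2, h3, h4, h5⟩ := hW
    have hM : ∑ k, ((Sum.elim (Sum.elim (lam i) fun u => mu u.1 u.2) (tau i) k : ℝ) : ℂ) • A k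
        = S.structureMatrix P lam mu tau i := by
      rw [Fintype.sum_sum_type, Fintype.sum_sum_type, Fintype.sum_prod_type]
      rfl
    have hdet : IsUnit (S.structureMatrix P lam mu tau i).det :=
      (Matrix.isUnit_iff_isUnit_det _).1 (h4 i).isUnit
    refine hC _ _ (c i j * (Real.sqrt (userPower W i j) : ℂ)
      * ((‖S.structureVector P lam mu tau i j‖⁻¹ : ℝ) : ℂ)) ?_ (hM ▸ h4 i) ?_
    · rintro ((k | u) | n)
      exacts [(h1 i k).1, (h2 u.1 u.2).1, (h3 i n).1]
    · have hW' := congrArg (fun v => S.structureMatrix P lam mu tau i *ᵥ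
        (v : EuclideanSpace ℂ (Fin Nt)).ofLp) (h5 i j)
      dsimp only at hW'
      rw [hM, hW', structureDirection, smul_smul, WithLp.ofLp_smul, Matrix.mulVec_smul,
        structureVector, Matrix.mulVec_mulVec, Matrix.mul_nonsing_inv _ hdet, Matrix.one_mulVec]
  choose C hC0 hC using hex
  refine ⟨∑ i, ∑ j, C i j + 1, ?_, fun W c hW i j => (hC i j W c hW).trans ?_⟩
  · have : 0 ≤ ∑ i, ∑ j, C i j :=
      Finset.sum_nonneg fun i _ => Finset.sum_nonneg fun j _ => (hC0 i j).le
    linarith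
  · refine mul_le_mul_of_nonneg_right ?_ (norm_nonneg _)
    have h1 : C i j ≤ ∑ j, C i j :=
      Finset.single_le_sum (f := fun j => C i j) (fun j _ => (hC0 i j).le) (Finset.mem_univ j)
    have h2 : ∑ j, C i j ≤ ∑ i, ∑ j, C i j :=
      Finset.single_le_sum (f := fun i => ∑ j, C i j)
        (fun i _ => Finset.sum_nonneg fun j _ => (hC0 i j).le) (Finset.mem_univ i)
    linarith

/-- If `ν` grows faster than linearly, unimprovable beamformings with the structure have bounded
powers. Along a sequence with unbounded powers, resetting all users whose power tends to infinity
to power one improves every served user: the reset users have a received power, hence a receiver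
distortion, that drives their SINR to zero, and the others see less distortion. -/
lemma exists_userPower_le_of_nu (hh : ∀ m i j n, S.h m i j n ≠ 0)
    (hν : GrowsFasterThanLinear S.nu) (P : PowerShape N Nt) :
    ∃ A, ∀ (lim : P.Limits) (W : Beamforming N K Nt) (c : Fin N → Fin K → ℂ),
      (∀ i k, S.consumedPower P W i k ≤ lim i k) → S.Unimprovable P lim W →
        S.HasStructure P W c → ∀ i j, ‖W i j‖ ≤ A := by
  classical
  by_contra hcon
  push Not at hcon
  choose lim W c hle hunimp hstr a b hab using fun m : ℕ => hcon (m : ℝ)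
  obtain ⟨C, hC0, hC⟩ := S.exists_norm_le_of_hasStructure (K := K) P
  -- along the ultrafilter, every power is either bounded or tends to infinity
  let 𝓤 : Ultrafilter ℕ := hyperfilter ℕ
  have h𝓤 : (𝓤 : Filter ℕ) ≤ atTop := Nat.hyperfilter_le_atTop
  let Big : Fin N × Fin K → Prop := fun u => ∀ M : ℝ, ∀ᶠ m in (𝓤 : Filter ℕ), M < ‖W m u.1 u.2‖
  have hsmall : ∀ u, ∃ M : ℝ, 0 ≤ M ∧ (¬ Big u → ∀ᶠ m in (𝓤 : Filter ℕ), ‖W m u.1 u.2‖ ≤ M) := by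
    intro u
    by_cases hu : Big u
    · exact ⟨0, le_rfl, fun h => absurd hu h⟩
    · obtain ⟨M, hM⟩ := not_forall.1 hu
      rw [← Ultrafilter.eventually_not] at hM
      refine ⟨|M|, abs_nonneg M, fun _ => ?_⟩
      filter_upwards [hM] with m hm
      exact (not_lt.1 hm).trans (le_abs_self M)
  choose M hM0 hM using hsmall
  have hMle : ∀ u, M u ≤ ∑ u, M u := fun u =>
    Finset.single_le_sum (fun u _ => hM0 u) (Finset.mem_univ u)
  have hsm : ∀ᶠ m in (𝓤 : Filter ℕ), ∀ u, ¬ Big u → ‖W m u.1 u.2‖ ≤ M u := by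
    simp only [eventually_all]
    exact hM
  obtain ⟨⟨m₀, l₀⟩, hbig₀⟩ : ∃ u, Big u := by
    by_contra hno
    push Not at hno
    have h1 : ∀ᶠ m : ℕ in (𝓤 : Filter ℕ), ∑ u, M u ≤ (m : ℝ) :=
      (tendsto_natCast_atTop_atTop.eventually_ge_atTop (∑ u, M u)).filter_mono h𝓤
    obtain ⟨m, hm1, hm2⟩ := (hsm.and h1).exists
    have := hm1 (a m, b m) (hno _)
    linarith [hab m, hMle (a m, b m)]
  obtain ⟨C₀, hC₀, hI⟩ := S.exists_interferencePlusNoise_le (K := K) (∑ u, M u + 1)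
  obtain ⟨X, hX1, hX⟩ := hν.exists_lt S.nu_nonneg (Real.sqrt (C ^ 2 * C₀))
  have hbg : ∀ᶠ m in (𝓤 : Filter ℕ), ∀ u, Big u → max 1 (C * X) < ‖W m u.1 u.2‖ := by
    simp only [eventually_all]
    exact fun u hu => hu _
  obtain ⟨m, hm1, hm2⟩ := (hsm.and hbg).exists
  let θ : Fin N → Fin K → ℝ := fun i j => if Big (i, j) then ‖W m i j‖⁻¹ else 1
  have hθ : ∀ i j, θ i j ∈ Icc (0 : ℝ) 1 := by
    intro i j
    simp only [θ]
    split_ifs with hb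
    · exact ⟨by positivity, inv_le_one_of_one_le₀ ((le_max_left _ _).trans (hm2 (i, j) hb).le)⟩
    · simp
  have hsum0 : 0 ≤ ∑ u, M u := Finset.sum_nonneg fun u _ => hM0 u
  have hI' : ∀ i j, S.interferencePlusNoise (shrink θ (W m)) i j ≤ C₀ := by
    refine hI _ fun i j => ?_
    rw [shrink, norm_smul, Real.norm_of_nonneg (hθ i j).1]
    simp only [θ]
    split_ifs with hb
    · have : ‖W m i j‖ ≠ 0 := (one_pos.trans ((le_max_left _ _).trans_lt (hm2 (i, j) hb))).ne'
      rw [inv_mul_cancel₀ this]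
      linarith
    · rw [one_mul]
      linarith [hm1 (i, j) hb, hMle (i, j)]
  refine hunimp m (shrink θ (W m)) (fun i j hs => ?_) fun i k =>
    (consumedPower_shrink_le hθ P i k).trans (hle m i k)
  by_cases hb : Big (i, j)
  · have hw := hm2 (i, j) hb
    have hw0 : 0 < ‖W m i j‖ := one_pos.trans ((le_max_left _ _).trans_lt hw)
    have hal := hC (W m) (c m) (hstr m) i j
    set z := ‖(inner ℂ (S.h i i j) (W m i j) : ℂ)‖ with hz
    have hzX : X < z := by
      have : C * X < C * z := ((le_max_right _ _).trans_lt hw).trans_le hal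
      exact lt_of_mul_lt_mul_left this hC0.le
    have hz0 : 0 < z := by linarith
    -- the receiver distortion of the user exceeds its signal by a large factor
    have hnu : C ^ 2 * C₀ * z ^ 2 < S.interferencePlusNoise (W m) i j := by
      have h1 : z ≤ Real.sqrt (S.receivedPower (W m) i j) :=
        Real.le_sqrt_of_sq_le (S.signal_le_receivedPower (W m) i j)
      have h2 := hX _ (hzX.le.trans h1)
      have h3 := pow_lt_pow_left₀ h2 (by positivity) two_ne_zero
      rw [mul_pow, Real.sq_sqrt (by positivity)] at h3
      have h4 : z ^ 2 ≤ Real.sqrt (S.receivedPower (W m) i j) ^ 2 :=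
        pow_le_pow_left₀ hz0.le h1 2
      have h5 := nu_sq_le_interferencePlusNoise (S := S) (W m) i j
      have h6 : 0 < C ^ 2 * C₀ := by positivity
      nlinarith [mul_le_mul_of_nonneg_left h4 h6.le]
    have hI0 := S.interferencePlusNoise_pos (shrink θ (W m)) i j
    have hθij : θ i j = ‖W m i j‖⁻¹ := if_pos hb
    unfold sinr
    rw [norm_inner_shrink, hθij, ← hz, abs_of_pos (inv_pos.2 hw0)]
    calc z ^ 2 / S.interferencePlusNoise (W m) i j < 1 / (C ^ 2 * C₀) := by
          rw [div_lt_div_iff₀ (S.interferencePlusNoise_pos _ i j) (by positivity)]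
          linarith
      _ ≤ (‖W m i j‖⁻¹ * z) ^ 2 / C₀ := by
          have h1 : 1 / C ≤ ‖W m i j‖⁻¹ * z := by
            rw [div_le_iff₀ hC0, mul_assoc, le_inv_mul_iff₀ hw0]
            linarith
          rw [← div_div]
          gcongr
          calc 1 / C ^ 2 = (1 / C) ^ 2 := by rw [div_pow, one_pow]
            _ ≤ _ := pow_le_pow_left₀ (by positivity) h1 2
      _ ≤ _ := by
          gcongr
          exact hI' i j
  · have h1 : θ i j = 1 := if_neg hb
    have hw := hm2 (m₀, l₀) hbig₀
    have hw1 : 1 < ‖W m m₀ l₀‖ := (le_max_left _ _).trans_lt hw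
    have h2 : θ m₀ l₀ < 1 := by
      simp only [θ, if_pos hbig₀]
      exact inv_lt_one_of_one_lt₀ hw1
    refine sinr_lt_sinr_shrink hh hθ h1 h2 (fun h => ?_) hs
    rw [h, norm_zero] at hw1
    linarith

/-! ### The two optimization problems -/

/-- An optimal solution of (P1) is zero, or it is unimprovable under the power limits `β q`. -/
lemma IsOptimalQoS.eq_zero_or (hN : 0 < N) (hNt : 0 < Nt) (h0 : S.eta 0 = 0)
    (hh : ∀ m i j n, S.h m i j n ≠ 0) {P : PowerShape N Nt} {q : P.Limits}
    (hq : ∀ i k, 0 < q i k) {γ : Fin N → Fin K → ℝ} {β : ℝ} {W : Beamforming N K Nt}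
    (hW : S.IsOptimalQoS P q γ β W) :
    W = 0 ∨ (0 < β ∧ S.Unimprovable P (fun i k => β * q i k) W) := by
  have hh' : ∀ i j, S.h i i j ≠ 0 := fun i j h => hh i i j ⟨0, hNt⟩ (by simp [h])
  rcases (hW.1.nonneg hN hNt hq).eq_or_lt with hβ | hβ
  · left
    refine eq_zero_of_consumedPower_nonpos (S := S) (P := P) fun i k => ?_
    have := hW.1.2 i k
    rwa [← hβ, zero_mul] at this
  · exact Or.inr ⟨hβ, hW.unimprovable h0 hh' hq hβ⟩

lemma IsOptimalQoS.rotate {P : PowerShape N Nt} {q : P.Limits} {γ : Fin N → Fin K → ℝ} {β : ℝ}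
    {W : Beamforming N K Nt} (hW : S.IsOptimalQoS P q γ β W) {c : Fin N → Fin K → ℂ}
    (hc : ∀ i j, ‖c i j‖ = 1) : S.IsOptimalQoS P q γ β (rotate c W) := by
  refine ⟨⟨fun i j => ?_, fun i k => ?_⟩, hW.2⟩
  · rw [performance_rotate hc]; exact hW.1.1 i j
  · rw [consumedPower_rotate hc]; exact hW.1.2 i k

lemma IsOptimalFPO.rotate {P : PowerShape N Nt} {q : P.Limits} {a α : Fin N → Fin K → ℝ}
    {W : Beamforming N K Nt} (hW : S.IsOptimalFPO P q a α W) {c : Fin N → Fin K → ℂ}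
    (hc : ∀ i j, ‖c i j‖ = 1) : S.IsOptimalFPO P q a α (rotate c W) := by
  refine ⟨⟨fun i k => ?_, fun i j => ?_⟩, fun W' hW' => ?_⟩
  · rw [consumedPower_rotate hc]; exact hW.1.1 i k
  · rw [performance_rotate hc]; exact hW.1.2 i j
  · have : S.fairnessValue a α (DownlinkSystem.rotate c W) = S.fairnessValue a α W := by
      simp only [fairnessValue, performance_rotate hc]
    rw [this]; exact hW.2 W' hW'

lemma IsOptimalQoS.exists_hasStructure (hN : 0 < N) (hNt : 0 < Nt)
    (hη : ConvexOn ℝ (Ici 0) S.eta) (h0 : S.eta 0 = 0)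
    (hh : ∀ m i j n, S.h m i j n ≠ 0) {P : PowerShape N Nt} {q : P.Limits}
    (hq : ∀ i k, 0 < q i k) {γ : Fin N → Fin K → ℝ} {β : ℝ} {W : Beamforming N K Nt}
    (hW : S.IsOptimalQoS P q γ β W) :
    ∃ c : Fin N → Fin K → ℂ, (∀ i j, ‖c i j‖ = 1) ∧ S.HasStructure P W c := by
  rcases hW.eq_zero_or hN hNt h0 hh hq with rfl | ⟨hβ, hu⟩
  · exact ⟨fun _ _ => 1, by simp, hasStructure_zero P _⟩
  · exact hu.hasStructure hη h0 hh (fun i k => mul_pos hβ (hq i k)) hW.1.2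

/-- The powers in (P1) are bounded uniformly over all power constraints. -/
lemma exists_userPower_lt_of_isOptimalQoS (hN : 0 < N) (hNt : 0 < Nt) (h0 : S.eta 0 = 0)
    (hh : ∀ m i j n, S.h m i j n ≠ 0) (γ : Fin N → Fin K → ℝ)
    (hgrow : GrowsFasterThanLinear S.eta ∨
      (ConvexOn ℝ (Ici 0) S.eta ∧ GrowsFasterThanLinear S.nu)) :
    ∃ qmax : ℝ, ∀ (P : PowerShape N Nt) (q : P.Limits), (∀ i k, 0 < q i k) →
      ∀ β W, S.IsOptimalQoS P q γ β W → ∀ i j, userPower W i j < qmax := by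
  suffices hamp : ∃ A : ℝ, ∀ (P : PowerShape N Nt) (q : P.Limits), (∀ i k, 0 < q i k) →
      ∀ β W, S.IsOptimalQoS P q γ β W → W = 0 ∨ ∀ i n, antennaAmp (W i) n ≤ A by
    obtain ⟨A, hA⟩ := hamp
    refine ⟨Nt * A ^ 2 + 1, fun P q hq β W hW i j => ?_⟩
    rcases hA P q hq β W hW with rfl | hA
    · simp only [userPower, Pi.zero_apply, norm_zero, ne_eq, OfNat.ofNat_ne_zero,
        not_false_eq_true, zero_pow]
      positivity
    · exact (userPower_le_of_antennaAmp_le hA i j).trans_lt (lt_add_one _)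
  rcases hgrow with hη | ⟨hη, hν⟩
  · obtain ⟨A, hA⟩ := exists_antennaAmp_le_of_eta (K := K) hh hη
    exact ⟨A, fun P q hq β W hW => (hW.eq_zero_or hN hNt h0 hh hq).imp_right fun hu =>
      hA P _ W hW.1.2 hu.2⟩
  · by_cases hγ : ∃ i j, 0 < γ i j
    · obtain ⟨i, j, hij⟩ := hγ
      obtain ⟨A, hA⟩ := exists_antennaAmp_le_of_nu h0 hh hη hν hij
      exact ⟨A, fun P q hq β W hW => Or.inr (hA W (hW.1.1 i j))⟩
    · -- without demands, `W = 0` with `β = 0` is feasible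
      push Not at hγ
      refine ⟨0, fun P q hq β W hW => Or.inl ?_⟩
      have hzero : S.IsFeasibleQoS P q γ 0 (0 : Beamforming N K Nt) := by
        refine ⟨fun i j => (hγ i j).trans (S.performance_nonneg _ i j), fun i k => ?_⟩
        simp [consumedPower_eq, antennaAmp, h0, reForm]
      refine eq_zero_of_consumedPower_nonpos (S := S) (P := P) fun i k => (hW.1.2 i k).trans ?_
      exact mul_nonpos_of_nonpos_of_nonneg (hW.2 _ _ hzero) (hq i k).le

end DownlinkSystem

end

theorem theorem2 {N K Nt : ℕ} (hN : 0 < N) (hK : 0 < K) (hNt : 0 < Nt)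
    (S : DownlinkSystem N K Nt)
    (heta_zero : S.eta 0 = 0)
    (hh : ∀ m i j n, S.h m i j n ≠ 0) :
    -- problem (P1)
    (∀ γ : Fin N → Fin K → ℝ, (∀ i j, 0 ≤ γ i j) →
      (ConvexOn ℝ (Ici 0) S.eta →
        ∀ (P : PowerShape N Nt) (q : P.Limits), (∀ i k, 0 < q i k) →
        (∃ β W, S.IsFeasibleQoS P q γ β W) →
          (∃ β W, S.IsOptimalQoS P q γ β W ∧ S.HasStructure P W (fun _ _ => 1)) ∧
          (∀ β W, S.IsOptimalQoS P q γ β W →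
            ∃ c : Fin N → Fin K → ℂ, (∀ i j, ‖c i j‖ = 1) ∧ S.HasStructure P W c)) ∧
      (GrowsFasterThanLinear S.eta ∨
          (ConvexOn ℝ (Ici 0) S.eta ∧ GrowsFasterThanLinear S.nu) →
        ∃ qmax : ℝ, ∀ (P : PowerShape N Nt) (q : P.Limits), (∀ i k, 0 < q i k) →
          ∀ β W, S.IsOptimalQoS P q γ β W → ∀ i j, userPower W i j < qmax)) ∧
    -- problem (P2)
    (∀ a α : Fin N → Fin K → ℝ, (∀ i j, 0 ≤ a i j) → (∀ i j, 0 ≤ α i j) →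
      (∑ i, ∑ j, α i j = 1) →
      (ConvexOn ℝ (Ici 0) S.eta →
        ∀ (P : PowerShape N Nt) (q : P.Limits), (∀ i k, 0 < q i k) →
        (∃ W, S.IsFeasibleFPO P q a W) →
          (∃ W, S.IsOptimalFPO P q a α W ∧ S.HasStructure P W (fun _ _ => 1)) ∧
          (∀ W, S.IsOptimalFPO P q a α W →
            ∃ c : Fin N → Fin K → ℂ, (∀ i j, ‖c i j‖ = 1) ∧ S.HasStructure P W c)) ∧
      (GrowsFasterThanLinear S.eta →
        ∃ qmax : ℝ, ∀ (P : PowerShape N Nt) (q : P.Limits), (∀ i k, 0 < q i k) →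
          ∀ W, S.IsOptimalFPO P q a α W → ∀ i j, userPower W i j < qmax) ∧
      (ConvexOn ℝ (Ici 0) S.eta ∧ GrowsFasterThanLinear S.nu →
        ∀ P : PowerShape N Nt, ∃ qmax : ℝ, ∀ q : P.Limits, (∀ i k, 0 < q i k) →
          ∀ W, S.IsOptimalFPO P q a α W → ∀ i j, userPower W i j < qmax)) := by
  have hh' : ∀ i j, S.h i i j ≠ 0 := fun i j h => hh i i j ⟨0, hNt⟩ (by simp [h])
  refine ⟨fun γ _ => ⟨fun hη P q hq hf => ⟨?_, fun β W hW =>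
    hW.exists_hasStructure hN hNt hη heta_zero hh hq⟩,
    DownlinkSystem.exists_userPower_lt_of_isOptimalQoS hN hNt heta_zero hh γ⟩, fun a α _ _ hsum => ?_⟩
  · obtain ⟨β, W, hW⟩ := DownlinkSystem.exists_isOptimalQoS hN hNt hq hf
    obtain ⟨c, hc, hstr⟩ := hW.exists_hasStructure hN hNt hη heta_zero hh hq
    exact ⟨β, _, hW.rotate fun i j => by rw [norm_star]; exact hc i j, hstr.rotate_conj hc⟩
  have hstr : ConvexOn ℝ (Ici 0) S.eta → ∀ (P : PowerShape N Nt) (q : P.Limits),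
      (∀ i k, 0 < q i k) → ∀ W, S.IsOptimalFPO P q a α W →
      ∃ c : Fin N → Fin K → ℂ, (∀ i j, ‖c i j‖ = 1) ∧ S.HasStructure P W c :=
    fun hη P q hq W hW =>
      (hW.unimprovable heta_zero hh' hq hsum).hasStructure hη heta_zero hh hq hW.1.1
  refine ⟨fun hη P q hq hf => ⟨?_, hstr hη P q hq⟩, fun hη => ?_, fun ⟨hη, hν⟩ P => ?_⟩
  · obtain ⟨W, hW⟩ := DownlinkSystem.exists_isOptimalFPO hsum hf
    obtain ⟨c, hc, hs⟩ := hstr hη P q hq W hW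
    exact ⟨_, hW.rotate fun i j => by rw [norm_star]; exact hc i j, hs.rotate_conj hc⟩
  · obtain ⟨A, hA⟩ := DownlinkSystem.exists_antennaAmp_le_of_eta (K := K) hh hη
    exact ⟨Nt * A ^ 2 + 1, fun P q hq W hW i j => (DownlinkSystem.userPower_le_of_antennaAmp_le
      (hA P q W hW.1.1 (hW.unimprovable heta_zero hh' hq hsum)) i j).trans_lt (lt_add_one _)⟩
  · obtain ⟨A, hA⟩ := DownlinkSystem.exists_userPower_le_of_nu (K := K) hh hν P
    refine ⟨A ^ 2 + 1, fun q hq W hW i j => ?_⟩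
    obtain ⟨c, -, hs⟩ := hstr hη P q hq W hW
    have h1 := hA q W c hW.1.1 (hW.unimprovable heta_zero hh' hq hsum) hs i j
    exact (pow_le_pow_left₀ (norm_nonneg _) h1 2).trans_lt (lt_add_one _)
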